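/- **Theorem.** Let $D_6=\langle x,y\mid x^3=1,\,y^2=1,\,xyxy=1\rangle=\{1,x,x^2,y,xy,x^2y\}$, so that each element is uniquely $x^{a}y^{b}$ with $a\in\{0,1,2\}$, $b\in\{0,1\}$. Let $\mathcal Y$ be a finite set and let $W(\cdot\mid\cdot)$ be a discrete memoryless channel with input alphabet $D_6$ and output alphabet $\mathcal Y$. A *pseudo-group code* over $D_6$ of block length $n$ with $k$ information digits, $k\ge 0$, is given by pairs $(g_{ij},h_{ij})$, $1\le i\le n$, $1\le j\le k$, each of which is $(1,1)$ or one of the nine pairs with $g_{ij}\in\{1,x,x^2\}$ and $h_{ij}\in\{y,xy,x^2y\}$, and by a dither $B=(B_1,\dots,B_n)\in D_6^n$. It has the message set $D_6^k$ and encodes $u=(u_1,\dots,u_k)$, $u_j=x^{a_j}y^{b_j}$, as $c=(c_1,\dots,c_n)$ with $$c_i=g_{i1}^{a_1}h_{i1}^{b_1}\,g_{i2}^{a_2}h_{i2}^{b_2}\cdots g_{ik}^{a_k}h_{ik}^{b_k}\cdot B_i ,$$ so that its rate is $\frac kn\log_2 6$. In the *random ensemble* with parameters $(n,k)$ all pairs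 $(g_{ij},h_{ij})$ and all $B_i$ are independent, each pair is uniform on the ten pairs above, and each $B_i$ is uniform on $D_6$. Let $X$ be uniform on $D_6$, let $Y$ be the output of $W$ with input $X$, let $[X]$ be the coset of $\{1,x,x^2\}$ that contains $X$, and put $$R^*=\min\Big(\log_2 6-H(X|Y),\ \frac{\log_2 6}{\log_2 3}\big[\log_2 3-H(X|[X]Y)\big]\Big),$$ with entropies in bits. Then $R^*$ is achievable with pseudo-group codes over $D_6$: for every $\varepsilon>0$ and all sufficiently large $n$ there are a pseudo-group code of block length $n$ and rate at least $R^*-\varepsilon$, and a decoder, whose error probability over $W$, averaged over equiprobable messages, is at most $\varepsilon$. Moreover, the random ensemble achieves $R^*$: for every $\varepsilon>0$ and all sufficiently large $n$ there is a $k$ with $\frac kn\log_2 6\ge R^*-\varepsilon$ such that, with a suitable decoder for each code, the expectation over the $(n,k)$ ensemble of this average error probability is at most $\varepsilon$. -/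

import Mathlib

namespace PseudoGroup

/-! ### Discrete memoryless channels, transmission systems -/

/-- A discrete memoryless channel: a finite conditional probability law `W(y|x)`. -/
structure DMC (X Y : Type*) [Fintype Y] where
  /-- `prob x y` is `W(y|x)`. -/
  prob : X → Y → ℝ
  nonneg : ∀ x y, 0 ≤ prob x y
  sum_eq_one : ∀ x, ∑ y, prob x y = 1

/-- The memoryless extension `Wⁿ(y|x) = ∏ i, W(y_i|x_i)`. -/
noncomputable def DMC.power {X Y : Type*} [Fintype Y] (W : DMC X Y) {n : ℕ}
    (x : Fin n → X) (y : Fin n → Y) : ℝ :=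
  ∏ i, W.prob (x i) (y i)

/-- Average probability of error of the encoder `e` and the decoder `f` for equiprobable messages:
`(1/|M|) ∑ m, Wⁿ(f(Yⁿ) ≠ m | Xⁿ = e(m))`. -/
noncomputable def avgError {X Y M : Type*} [Fintype Y] [Fintype M] [DecidableEq M] (W : DMC X Y)
    {n : ℕ} (e : M → Fin n → X) (f : (Fin n → Y) → M) : ℝ :=
  (1 / (Fintype.card M : ℝ)) * ∑ m, ∑ y : Fin n → Y, if f y ≠ m then W.power (e m) y else 0

/-- `R` is achievable over the channel `W` with encoders from the class `𝒞` (`𝒞 n M` is a set of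
encoders of block length `n` with `M` messages): for all `ε > 0` and all sufficiently large `n`
there is a transmission system with encoder in `𝒞`, with rate at least `R - ε` (in bits) and
average error probability at most `ε`. -/
def IsAchievableUsing {X Y : Type*} [Fintype Y]
    (𝒞 : (n M : ℕ) → Set (Fin M → Fin n → X)) (W : DMC X Y) (R : ℝ) : Prop :=
  ∀ ε : ℝ, 0 < ε → ∃ N : ℕ, ∀ n : ℕ, N ≤ n →
    ∃ (M : ℕ) (e : Fin M → Fin n → X) (f : (Fin n → Y) → Fin M),
      e ∈ 𝒞 n M ∧ R - ε ≤ (1 / (n : ℝ)) * Real.logb 2 M ∧ avgError W e f ≤ ε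

/-! ### Conditional entropy of functions on a finite probability space -/

/-- Probability of the event `S` under the mass function `p`. -/
noncomputable def eventProb {Ω : Type*} [Fintype Ω] (p : Ω → ℝ) (S : Set Ω) : ℝ :=
  ∑ ω, S.indicator p ω

/-- `H(A|B) = E[-log₂ P(A|B)]` for random variables `A`, `B` on the finite space `(Ω, p)`. -/
noncomputable def condEntropy {Ω α β : Type*} [Fintype Ω] (p : Ω → ℝ) (A : Ω → α) (B : Ω → β) :
    ℝ :=
  -∑ ω, p ω * Real.logb 2
    (eventProb p {ω' | A ω' = A ω ∧ B ω' = B ω} / eventProb p {ω' | B ω' = B ω})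

/-! ### The group `D₆` -/

/-- The dihedral group of order `6`, `⟨x, y | x³ = y² = xyxy = 1⟩`. -/
abbrev D6 : Type := DihedralGroup 3

/-- The rotation generator. -/
def x : D6 := DihedralGroup.r 1

/-- The reflection generator. -/
def y : D6 := DihedralGroup.sr 0

/-- The exponent `α ∈ {0, 1, 2}` in `u = x ^ α * y ^ β`. -/
def xExp : D6 → ℕ
  | DihedralGroup.r i => i.val
  | DihedralGroup.sr i => (-i).val

/-- The exponent `β ∈ {0, 1}` in `u = x ^ α * y ^ β`. -/
def yExp : D6 → ℕ
  | DihedralGroup.r _ => 0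
  | DihedralGroup.sr _ => 1

theorem presentation : x ^ 3 = 1 ∧ y ^ 2 = 1 ∧ x * y * x * y = 1 := by decide

theorem exp_unique : ∀ (u : D6) (α : Fin 3) (β : Fin 2),
    u = x ^ (α : ℕ) * y ^ (β : ℕ) ↔ (α : ℕ) = xExp u ∧ (β : ℕ) = yExp u := by decide

theorem eq_x_pow_mul_y_pow : ∀ u : D6, u = x ^ xExp u * y ^ yExp u := by decide

/-! ### Pseudo-group codes over `D₆` -/

/-- The pairs `(g, h)` of positive probability: `(1, 1)` and the nine pairs of
a rotation `g ∈ {1, x, x²}` and a reflection `h ∈ {y, xy, x²y}`. -/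
def generatorTable : Finset (D6 × D6) :=
  insert (1, 1) (({1, x, x ^ 2} : Finset D6) ×ˢ ({y, x * y, x ^ 2 * y} : Finset D6))

theorem card_generatorTable : generatorTable.card = 10 := by decide

/-- The table lists exactly the pairs satisfying the defining relations of `D₆`. -/
theorem mem_generatorTable : ∀ g h : D6,
    (g, h) ∈ generatorTable ↔ g ^ 3 = 1 ∧ h ^ 2 = 1 ∧ g * h * g * h = 1 := by decide

/-- The probability with which a pair `(g, h)` is drawn: uniform on the ten pairs of the table. -/
noncomputable def pairProb (p : D6 × D6) : ℝ := if p ∈ generatorTable then 1 / 10 else 0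

/-- Generator pairs `(g_ij, h_ij)` and dither `B` of a code with `k` input and `n` output digits. -/
abbrev CodeParams (n k : ℕ) : Type := (Fin n → Fin k → D6 × D6) × (Fin n → D6)

/-- All generator pairs are taken from the table. -/
def CodeParams.Admissible {n k : ℕ} (P : CodeParams n k) : Prop :=
  ∀ i j, P.1 i j ∈ generatorTable

/-- The encoder `c = G(u) · B`: for `u_j = x ^ a_j * y ^ b_j`,
`c_i = g_i1 ^ a_1 * h_i1 ^ b_1 * g_i2 ^ a_2 * h_i2 ^ b_2 * ⋯ * g_ik ^ a_k * h_ik ^ b_k * B_i`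
(an ordered product). -/
def CodeParams.encode {n k : ℕ} (P : CodeParams n k) (u : Fin k → D6) : Fin n → D6 := fun i =>
  (List.ofFn fun j : Fin k =>
    (P.1 i j).1 ^ xExp (u j) * (P.1 i j).2 ^ yExp (u j)).prod * P.2 i

/-- Probability of a code in the random ensemble: all generator pairs and all dither digits are
independent, the pairs distributed by `pairProb` and the dither digits uniform on `D₆`. -/
noncomputable def CodeParams.ensembleProb {n k : ℕ} (P : CodeParams n k) : ℝ :=
  (∏ i, ∏ j, pairProb (P.1 i j)) * ∏ _i : Fin n, (1 / 6 : ℝ)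

/-- The encoders of pseudo-group codes over `D₆` of block length `n` with `M` messages; here
`M = 6 ^ k`, and the messages are numbered by some bijection with `D₆ ^ k`. -/
def pseudoGroupEncoders (n M : ℕ) : Set (Fin M → Fin n → D6) :=
  {e | ∃ (k : ℕ) (P : CodeParams n k) (σ : Fin M ≃ (Fin k → D6)),
    P.Admissible ∧ ∀ m, e m = P.encode (σ m)}

/-- `R` is achieved by the random ensemble on the average: for all `ε > 0` and all sufficiently
large `n` there is a `k` such that the rate `(k / n) log₂ 6` is at least `R - ε`, and the expectation
over the ensemble of the average error probability, with a decoder that knows the code, is at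
most `ε`. -/
def IsAchievableByEnsemble {Y : Type*} [Fintype Y] (W : DMC D6 Y) (R : ℝ) : Prop :=
  ∀ ε : ℝ, 0 < ε → ∃ N : ℕ, ∀ n : ℕ, N ≤ n →
    ∃ (k : ℕ) (dec : CodeParams n k → (Fin n → Y) → (Fin k → D6)),
      R - ε ≤ ((k : ℝ) / n) * Real.logb 2 6 ∧
      ∑ P : CodeParams n k, P.ensembleProb * avgError W P.encode (dec P) ≤ ε

/-! ### The rate -/

/-- The joint law of `(X, Y)` for uniform `X`: `P(x, y) = W(y|x) / 6`. -/
noncomputable def jointLaw {Y : Type*} [Fintype Y] (W : DMC D6 Y) (ω : D6 × Y) : ℝ :=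
  (1 / 6) * W.prob ω.1 ω.2

/-- The rotation subgroup `{1, x, x²}`. -/
def rotations : Subgroup D6 := Subgroup.zpowers x

/-- `R* = min(log₂ 6 - H(X|Y), (log₂ 6 / log₂ 3) (log₂ 3 - H(X|[X]Y)))`, where `[X]` is the coset
of the rotation subgroup that contains `X`. -/
noncomputable def rateStar {Y : Type*} [Fintype Y] (W : DMC D6 Y) : ℝ :=
  min (Real.logb 2 6 - condEntropy (jointLaw W) Prod.fst Prod.snd)
    (Real.logb 2 6 / Real.logb 2 3 *
      (Real.logb 2 3 - condEntropy (jointLaw W) Prod.fst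
        (fun ω => ((QuotientGroup.mk ω.1 : D6 ⧸ rotations), ω.2))))

end PseudoGroup

/-!
Decode by maximum likelihood. The dither makes every codeword uniform, and for two messages `u`, `v`
the letters `c`, `c'` of their codewords are independent over the positions, with a ratio `c' * c⁻¹`
independent of `c`. The law of this ratio is explicit (`ratioLaw_eq`): with `D` the Hamming distance
of `u` and `v`, and `e` the number of positions where their `y`-exponents differ, it is the point
mass `10 ^ (-D)` at `1` plus a multiple of the uniform law on each of the two cosets of rotations,
the sign having mean `(-4/5) ^ e`. This is an induction on the number of digits, each step a finite
identity over the ten generator pairs.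

Fix a large constant `m`. The competitors `v` of the transmitted `u` fall into three classes.
* `D ≤ m`: only subexponentially many, and each loses exponentially because the channel separates
  two inputs in a common coset (`exists_sum_ratioLaw_bhattacharyya_le`); if it did not, then
  `R* ≤ 0`.
* `e ≤ m < D`: about `3 ^ k` of them. The ratio is almost uniform given its coset, so the threshold
  `P(y|[c])` yields the exponent `log 3 - H(X|[X]Y)`, whatever the law of the coset of the ratio
  (`sum_ratioLaw_cosetOutput_le`).
* `m < e`: at most `6 ^ k`. The ratio is almost uniform, and the threshold `P(y)` yields the
  exponent `log 6 - H(X|Y)` (`sum_ratioLaw_output_le`).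

The information densities are below their thresholds with exponentially small probability by a
Chernoff bound (`exists_chernoff_exponent`). All these events are dominated pointwise by products
over the letters (`error_indicator_le`), so that the expectation over the ensemble factorizes
(`sum_ensembleProb_mul_sum_prod`). The existence of one good code follows by averaging.
-/

namespace PseudoGroup

/-! ### The law of the ratio of two codeword letters -/

/-- The sign character of `D₆`: `1` on rotations and `-1` on reflections. -/
def sign : D6 → ℤ
  | DihedralGroup.r _ => 1
  | DihedralGroup.sr _ => -1

/-- Three times the difference between the point mass at `1` and the uniform law on the
rotations. -/
def oneDefect : D6 → ℤ
  | DihedralGroup.r i => if i = 0 then 2 else -1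
  | DihedralGroup.sr _ => 0

/-- The letter `g ^ a * h ^ b` contributed to a codeword by the pair `p = (g, h)` and the
information digit `u = x ^ a * y ^ b`. -/
def letter (p : D6 × D6) (u : D6) : D6 := p.1 ^ xExp u * p.2 ^ yExp u

theorem sum_oneDefect_letter : ∀ a b t : D6,
    ∑ p ∈ generatorTable, oneDefect ((letter p b)⁻¹ * t * letter p a) =
      (if a = b then 10 else 1) * oneDefect t := by
  decide +kernel

theorem sum_sign_letter : ∀ a b t : D6,
    ∑ p ∈ generatorTable, sign ((letter p b)⁻¹ * t * letter p a) =
      (if yExp a = yExp b then 10 else -8) * sign t := by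
  decide +kernel

/-- The codeword letter before dithering, for one row `p` of generator pairs. -/
def rowProd {k : ℕ} (p : Fin k → D6 × D6) (u : Fin k → D6) : D6 :=
  (List.ofFn fun j => letter (p j) (u j)).prod

/-- Probability of a row of generator pairs. -/
noncomputable def rowProb {k : ℕ} (p : Fin k → D6 × D6) : ℝ := ∏ j, pairProb (p j)

/-- The law of the ratio `c' * c⁻¹` of the codeword letters `c`, `c'` of the messages `u`, `v`. -/
noncomputable def ratioLaw {k : ℕ} (u v : Fin k → D6) (t : D6) : ℝ :=
  ∑ p : Fin k → D6 × D6, if rowProd p v * (rowProd p u)⁻¹ = t then rowProb p else 0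

/-- `10 ^ (-D)`, where `D` is the Hamming distance of the messages `u` and `v`. -/
noncomputable def digitFactor {k : ℕ} (u v : Fin k → D6) : ℝ :=
  ∏ j, if u j = v j then (1 : ℝ) else 1 / 10

/-- `(-4/5) ^ e`, where `e` is the number of positions in which the `y`-exponents of the messages
`u` and `v` differ. -/
noncomputable def signFactor {k : ℕ} (u v : Fin k → D6) : ℝ :=
  ∏ j, if yExp (u j) = yExp (v j) then (1 : ℝ) else -4 / 5

theorem pairProb_nonneg (p : D6 × D6) : 0 ≤ pairProb p := by
  unfold pairProb; split_ifs <;> norm_num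

theorem sum_pairProb_mul (f : D6 × D6 → ℝ) :
    ∑ p, pairProb p * f p = (1 / 10) * ∑ p ∈ generatorTable, f p := by
  simp [pairProb, ite_mul, Finset.sum_ite_mem, Finset.mul_sum]

theorem rowProb_nonneg {k : ℕ} (p : Fin k → D6 × D6) : 0 ≤ rowProb p :=
  Finset.prod_nonneg fun _ _ => pairProb_nonneg _

theorem ratioLaw_nonneg {k : ℕ} (u v : Fin k → D6) (t : D6) : 0 ≤ ratioLaw u v t :=
  Finset.sum_nonneg fun p _ => by split_ifs <;> [exact rowProb_nonneg p; exact le_rfl]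

theorem ratioLaw_succ {k : ℕ} (u v : Fin (k + 1) → D6) (t : D6) :
    ratioLaw u v t = ∑ p, pairProb p * ratioLaw (fun j => u j.succ) (fun j => v j.succ)
      ((letter p (v 0))⁻¹ * t * letter p (u 0)) := by
  unfold ratioLaw
  rw [← (Fin.consEquiv fun _ => D6 × D6).sum_comp, Fintype.sum_prod_type]
  refine Finset.sum_congr rfl fun p _ => ?_
  rw [Finset.mul_sum]
  refine Finset.sum_congr rfl fun q _ => ?_
  have h (w : Fin (k + 1) → D6) : rowProd (Fin.cons p q : Fin (k + 1) → D6 × D6) w =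
      letter p (w 0) * rowProd q (fun j => w j.succ) := by
    simp [rowProd, List.ofFn_succ]
  have h' : rowProb (Fin.cons p q : Fin (k + 1) → D6 × D6) = pairProb p * rowProb q := by
    simp [rowProb, Fin.prod_univ_succ]
  rw [show (Fin.consEquiv fun _ => D6 × D6) (p, q) = Fin.cons p q from rfl]
  simp only [h, h', mul_ite, mul_zero]
  refine if_congr ?_ rfl rfl
  constructor
  · rintro rfl; group
  · intro e
    calc _ = letter p (v 0) * (rowProd q (fun j => v j.succ) *
          (rowProd q fun j => u j.succ)⁻¹) * (letter p (u 0))⁻¹ := by group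
      _ = t := by rw [e]; group

/-- The nine nontrivial pairs make the ratio uniform on its coset of rotations as soon as the
two messages differ, and flip the coset where the `y`-exponents differ. -/
theorem ratioLaw_eq {k : ℕ} (u v : Fin k → D6) (t : D6) :
    ratioLaw u v t =
      digitFactor u v * oneDefect t / 3 + (1 + signFactor u v * sign t) / 6 := by
  induction k generalizing t with
  | zero =>
    have h : ∀ t : D6, (if (1 : D6) = t then (6 : ℤ) else 0) = 2 * oneDefect t + (1 + sign t) := by
      decide
    have h := congrArg (Int.cast : ℤ → ℝ) (h t)
    push_cast at h
    simp only [ratioLaw, rowProd, rowProb, digitFactor, signFactor, Finset.univ_unique,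
      Finset.sum_singleton, List.ofFn_zero, List.prod_nil, Finset.univ_eq_empty,
      Finset.prod_empty, inv_one, mul_one, one_mul]
    split_ifs at h ⊢ <;> linarith
  | succ k ih =>
    rw [ratioLaw_succ, sum_pairProb_mul]
    simp only [ih]
    rw [Finset.sum_add_distrib, ← Finset.sum_div, ← Finset.mul_sum, ← Finset.sum_div,
      Finset.sum_add_distrib, ← Finset.mul_sum, Finset.sum_const, card_generatorTable]
    have h1 := congrArg (Int.cast : ℤ → ℝ) (sum_oneDefect_letter (u 0) (v 0) t)
    have h2 := congrArg (Int.cast : ℤ → ℝ) (sum_sign_letter (u 0) (v 0) t)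
    push_cast at h1 h2
    rw [h1, h2]
    simp only [digitFactor, signFactor, Fin.prod_univ_succ]
    split_ifs <;> (simp only [nsmul_eq_mul]; push_cast; ring)

theorem sum_D6 (f : D6 → ℝ) : ∑ t, f t =
    f (.r 0) + f (.r 1) + f (.r 2) + (f (.sr 0) + f (.sr 1) + f (.sr 2)) := by
  have : (Finset.univ : Finset D6) = {.r 0, .r 1, .r 2, .sr 0, .sr 1, .sr 2} := by decide
  rw [this]
  repeat rw [Finset.sum_insert (by decide)]
  rw [Finset.sum_singleton]; ring

theorem sum_ratioLaw_mul {k : ℕ} (u v : Fin k → D6) (β : D6 → ℝ) :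
    ∑ t, ratioLaw u v t * β t = digitFactor u v * β (.r 0) +
      ((1 + signFactor u v) / 2 - digitFactor u v) * ((β (.r 0) + β (.r 1) + β (.r 2)) / 3) +
      (1 - signFactor u v) / 2 * ((β (.sr 0) + β (.sr 1) + β (.sr 2)) / 3) := by
  rw [sum_D6]
  simp only [ratioLaw_eq, show oneDefect (.r 0) = 2 from rfl,
    show oneDefect (.r 1) = -1 from rfl, show oneDefect (.r 2) = -1 from rfl,
    show ∀ j, oneDefect (.sr j) = 0 from fun _ => rfl, sign]
  push_cast; ring

theorem sum_ratioLaw {k : ℕ} (u v : Fin k → D6) : ∑ t, ratioLaw u v t = 1 := by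
  have := sum_ratioLaw_mul u v fun _ => 1
  simp only [mul_one] at this
  rw [this]; ring

/-! ### Expectations over the ensemble -/

theorem prod_sum_pow {α : Type*} [Fintype α] (n : ℕ) (f : α → ℝ) :
    ∑ a : Fin n → α, ∏ i, f (a i) = (∑ a, f a) ^ n := by
  classical
  rw [← Fintype.card_fin n, ← Finset.card_univ, ← Finset.prod_const, Finset.prod_univ_sum,
    Fintype.piFinset_univ, Finset.card_univ, Fintype.card_fin]

/-- The codewords of two messages are memoryless: the first codeword is uniform by the dither, and
the ratio of the second to the first is independent of the first. -/
theorem sum_ensembleProb_mul_prod {n k : ℕ} (u v : Fin k → D6) (φ : D6 → D6 → ℝ) :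
    ∑ P : CodeParams n k, P.ensembleProb * ∏ i, φ (P.encode u i) (P.encode v i) =
      ((1 / 6) * ∑ c, ∑ t, ratioLaw u v t * φ c (t * c)) ^ n := by
  have key : (∑ b : (Fin k → D6 × D6) × D6,
      rowProb b.1 * (1 / 6) * φ (rowProd b.1 u * b.2) (rowProd b.1 v * b.2)) =
      (1 / 6) * ∑ c, ∑ t, ratioLaw u v t * φ c (t * c) := by
    rw [Fintype.sum_prod_type, Finset.mul_sum]
    have h1 (p : Fin k → D6 × D6) : ∑ b : D6, rowProb p * (1 / 6) *
        φ (rowProd p u * b) (rowProd p v * b) =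
        ∑ c : D6, rowProb p * (1 / 6) * φ c (rowProd p v * (rowProd p u)⁻¹ * c) :=
      Fintype.sum_equiv (Equiv.mulLeft (rowProd p u)) _ _ fun b => by
        simp [mul_assoc]
    simp only [h1]
    rw [Finset.sum_comm]
    refine Finset.sum_congr rfl fun c _ => ?_
    simp only [ratioLaw, Finset.sum_mul]
    rw [Finset.sum_comm, Finset.mul_sum]
    refine Finset.sum_congr rfl fun p _ => ?_
    simp only [ite_mul, zero_mul, Finset.sum_ite_eq, Finset.mem_univ, if_true]
    ring
  rw [← key, ← prod_sum_pow]
  refine Fintype.sum_equiv (Equiv.arrowProdEquivProdArrow (Fin n) (fun _ => Fin k → D6 × D6)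
    (fun _ => D6)).symm _ _ fun P => ?_
  simp only [CodeParams.ensembleProb, ← Finset.prod_mul_distrib]
  rfl

/-! ### Pairwise bounds for one letter -/

theorem digitFactor_nonneg {k : ℕ} (u v : Fin k → D6) : 0 ≤ digitFactor u v :=
  Finset.prod_nonneg fun _ _ => by split_ifs <;> norm_num

theorem digitFactor_le_signFactor {k : ℕ} (u v : Fin k → D6) :
    digitFactor u v ≤ (1 + signFactor u v) / 2 := by
  have h := ratioLaw_nonneg u v (.r 1)
  rw [ratioLaw_eq, show oneDefect (.r 1) = -1 from rfl, sign] at h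
  push_cast at h; linarith

theorem signFactor_le_one {k : ℕ} (u v : Fin k → D6) : signFactor u v ≤ 1 := by
  have h := ratioLaw_nonneg u v (.sr 1)
  rw [ratioLaw_eq, oneDefect, sign] at h
  push_cast at h; linarith

theorem digitFactor_le {k : ℕ} {u v : Fin k → D6} (h : u ≠ v) : digitFactor u v ≤ 1 / 10 := by
  obtain ⟨j, hj⟩ := Function.ne_iff.1 h
  unfold digitFactor
  rw [← Finset.mul_prod_erase _ _ (Finset.mem_univ j), if_neg hj]
  refine mul_le_of_le_one_right (by norm_num) (Finset.prod_le_one (fun _ _ => ?_) fun _ _ => ?_)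
  all_goals split_ifs <;> norm_num

variable {Y : Type*} [Fintype Y]

/-- The probability `P(y|[c])` of the output `y`, given the coset of rotations of the input. -/
noncomputable def DMC.cosetOutput (W : DMC D6 Y) (c : D6) (y : Y) : ℝ :=
  (W.prob (.r 0 * c) y + W.prob (.r 1 * c) y + W.prob (.r 2 * c) y) / 3

/-- The probability of the output `y` under the uniform input law, as a function of an irrelevant
input `c`, so that it can be used in place of `DMC.cosetOutput`. -/
noncomputable def DMC.output (W : DMC D6 Y) (_c : D6) (y : Y) : ℝ :=
  (1 / 6) * ∑ c, W.prob c y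

theorem sum_mulLeft (r : D6) (f : D6 → ℝ) : ∑ c, f (r * c) = ∑ c, f c :=
  Fintype.sum_equiv (Equiv.mulLeft r) _ _ fun _ => rfl

theorem sum_mulRight (r : D6) (f : D6 → ℝ) : ∑ c, f (c * r) = ∑ c, f c :=
  Fintype.sum_equiv (Equiv.mulRight r) _ _ fun _ => rfl

theorem r_zero_mul (c : D6) : DihedralGroup.r 0 * c = c := one_mul c

theorem cosetOutput_nonneg (W : DMC D6 Y) (c : D6) (y : Y) : 0 ≤ W.cosetOutput c y := by
  have := fun c => W.nonneg c y
  unfold DMC.cosetOutput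
  have h0 := this (.r 0 * c); have h1 := this (.r 1 * c); have h2 := this (.r 2 * c)
  positivity

theorem output_nonneg (W : DMC D6 Y) (c : D6) (y : Y) : 0 ≤ W.output c y :=
  mul_nonneg (by norm_num) (Finset.sum_nonneg fun _ _ => W.nonneg _ _)

theorem cosetOutput_pos (W : DMC D6 Y) {c : D6} {y : Y} (h : 0 < W.prob c y) :
    0 < W.cosetOutput c y := by
  have := fun c => W.nonneg c y
  unfold DMC.cosetOutput
  rw [r_zero_mul]
  have h1 := this (.r 1 * c); have h2 := this (.r 2 * c)
  positivity

theorem output_pos (W : DMC D6 Y) {c : D6} {y : Y} (h : 0 < W.prob c y) : 0 < W.output c y :=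
  mul_pos (by norm_num)
    (Finset.sum_pos' (fun _ _ => W.nonneg _ _) ⟨c, Finset.mem_univ c, h⟩)

theorem sum_cosetOutput (W : DMC D6 Y) (c : D6) : ∑ y, W.cosetOutput c y = 1 := by
  simp only [DMC.cosetOutput, ← Finset.sum_div, Finset.sum_add_distrib, W.sum_eq_one]
  norm_num

theorem cosetOutput_rotation (W : DMC D6 Y) (c : D6) (y : Y) :
    W.cosetOutput (.r 1 * c) y = W.cosetOutput c y ∧
      W.cosetOutput (.r 2 * c) y = W.cosetOutput c y := by
  simp only [DMC.cosetOutput, ← mul_assoc, DihedralGroup.r_mul_r]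
  constructor
  · rw [show (0 : ZMod 3) + 1 = 1 from rfl, show (1 : ZMod 3) + 1 = 2 from rfl,
      show (2 : ZMod 3) + 1 = 0 from rfl]; ring
  · rw [show (0 : ZMod 3) + 2 = 2 from rfl, show (1 : ZMod 3) + 2 = 0 from rfl,
      show (2 : ZMod 3) + 2 = 1 from rfl]; ring

/-- Averaging over rotations turns `W` into the coset output law. -/
theorem sum_prob_mul_of_rotation (W : DMC D6 Y) (g : D6 → ℝ) (y : Y)
    (h1 : ∀ c, g (.r 1 * c) = g c) (h2 : ∀ c, g (.r 2 * c) = g c) :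
    ∑ c, W.prob c y * g c = ∑ c, W.cosetOutput c y * g c := by
  have e1 := sum_mulLeft (.r 1) fun c => W.prob c y * g c
  have e2 := sum_mulLeft (.r 2) fun c => W.prob c y * g c
  simp only [h1] at e1
  simp only [h2] at e2
  have : ∑ c, W.cosetOutput c y * g c = (∑ c, W.prob c y * g c +
      ∑ c, W.prob (.r 1 * c) y * g c + ∑ c, W.prob (.r 2 * c) y * g c) / 3 := by
    rw [← Finset.sum_add_distrib, ← Finset.sum_add_distrib, Finset.sum_div]
    refine Finset.sum_congr rfl fun c _ => ?_
    rw [DMC.cosetOutput, r_zero_mul]; ring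
  rw [this, e1, e2]; ring

/-- For the competitors with almost uniform rotation part, the threshold `P(y|[c])` costs nothing
regardless of how the cosets of the two codeword letters are correlated. -/
theorem sum_ratioLaw_cosetOutput_le (W : DMC D6 Y) {k : ℕ} (u v : Fin k → D6) :
    (1 / 6) * ∑ c, ∑ t, ratioLaw u v t *
      ∑ y, W.prob c y * (W.prob (t * c) y / W.cosetOutput c y) ≤ 1 + 2 * digitFactor u v := by
  set d := digitFactor u v
  set s := signFactor u v
  have hd : 0 ≤ d := digitFactor_nonneg u v
  have hds : d ≤ (1 + s) / 2 := digitFactor_le_signFactor u v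
  have hs : s ≤ 1 := signFactor_le_one u v
  let g (y : Y) (c : D6) : ℝ := ((2 * d + (1 + s) / 2) * W.cosetOutput c y +
      (1 - s) / 2 * W.cosetOutput (.sr 0 * c) y) / W.cosetOutput c y
  have hodd (c : D6) (y : Y) : (W.prob (.sr 0 * c) y + W.prob (.sr 1 * c) y +
      W.prob (.sr 2 * c) y) / 3 = W.cosetOutput (.sr 0 * c) y := by
    simp only [DMC.cosetOutput, ← mul_assoc, DihedralGroup.r_mul_sr]
    rw [show (0 : ZMod 3) - 0 = 0 from rfl, show (0 : ZMod 3) - 1 = 2 from rfl,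
      show (0 : ZMod 3) - 2 = 1 from rfl]; ring
  have hrot (j : ZMod 3) (c : D6) (y : Y) :
      W.cosetOutput (.sr 0 * (.r j * c)) y = W.cosetOutput (.sr 0 * c) y := by
    rw [← hodd, ← hodd]
    simp only [← mul_assoc, DihedralGroup.sr_mul_r]
    fin_cases j
    · rfl
    · change (W.prob (.sr 1 * c) y + W.prob (.sr 2 * c) y + W.prob (.sr 0 * c) y) / 3 = _
      ring
    · change (W.prob (.sr 2 * c) y + W.prob (.sr 0 * c) y + W.prob (.sr 1 * c) y) / 3 = _
      ring
  have h1 : ∑ c, ∑ t, ratioLaw u v t *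
      ∑ y, W.prob c y * (W.prob (t * c) y / W.cosetOutput c y) ≤
      ∑ c, ∑ y, W.prob c y * g y c := by
    refine Finset.sum_le_sum fun c _ => ?_
    rw [Finset.sum_congr rfl fun t _ => Finset.mul_sum _ _ _, Finset.sum_comm]
    refine Finset.sum_le_sum fun y _ => ?_
    have : ∑ t, ratioLaw u v t * (W.prob c y * (W.prob (t * c) y / W.cosetOutput c y)) =
        W.prob c y * ((∑ t, ratioLaw u v t * W.prob (t * c) y) / W.cosetOutput c y) := by
      rw [Finset.sum_div, Finset.mul_sum]
      exact Finset.sum_congr rfl fun t _ => by ring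
    rw [this]
    refine mul_le_mul_of_nonneg_left (div_le_div_of_nonneg_right ?_ (cosetOutput_nonneg W c y))
      (W.nonneg c y)
    rw [sum_ratioLaw_mul, hodd]
    have e : W.prob (.r 0 * c) y ≤ 3 * W.cosetOutput c y := by
      unfold DMC.cosetOutput
      linarith [W.nonneg (.r 1 * c) y, W.nonneg (.r 2 * c) y]
    have e' := mul_le_mul_of_nonneg_left e hd
    change d * _ + ((1 + s) / 2 - d) * W.cosetOutput c y + _ ≤ _
    linarith
  have h2 : ∑ c, ∑ y, W.prob c y * g y c = ∑ c, ∑ y, W.cosetOutput c y * g y c := by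
    refine Finset.sum_comm.trans (Eq.trans ?_ Finset.sum_comm)
    refine Finset.sum_congr rfl fun y _ => sum_prob_mul_of_rotation W (g y) y ?_ ?_
    · intro c
      simp only [g, hrot, (cosetOutput_rotation W c y).1]
    · intro c
      simp only [g, hrot, (cosetOutput_rotation W c y).2]
  have h3 (c : D6) : ∑ y, W.cosetOutput c y * g y c ≤ 1 + 2 * d := by
    calc _ ≤ ∑ y, ((2 * d + (1 + s) / 2) * W.cosetOutput c y +
          (1 - s) / 2 * W.cosetOutput (.sr 0 * c) y) := by
          refine Finset.sum_le_sum fun y _ => ?_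
          have h0 := cosetOutput_nonneg W c y
          have h0' := cosetOutput_nonneg W (.sr 0 * c) y
          simp only [g]
          rw [mul_div_left_comm]
          refine mul_le_of_le_one_right ?_ (div_self_le_one _)
          have : 0 ≤ (1 + s) / 2 := hd.trans hds
          have : 0 ≤ (1 - s) / 2 := by linarith
          positivity
      _ = 1 + 2 * d := by
          rw [Finset.sum_add_distrib, ← Finset.mul_sum, ← Finset.mul_sum, sum_cosetOutput,
            sum_cosetOutput]
          ring
  have h4 := Finset.sum_le_sum fun c (_ : c ∈ Finset.univ) => h3 c
  rw [Finset.sum_const, Finset.card_univ, show Fintype.card D6 = 6 from rfl] at h4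
  rw [h2] at h1
  simp only [nsmul_eq_mul, Nat.cast_ofNat] at h4
  linarith

theorem ratioLaw_le {k : ℕ} (u v : Fin k → D6) (t : D6) :
    ratioLaw u v t ≤ (1 + 4 * digitFactor u v + |signFactor u v|) / 6 := by
  have h1 := le_abs_self (signFactor u v)
  have h2 := neg_abs_le (signFactor u v)
  have hd := digitFactor_nonneg u v
  have key : ∀ t : D6, oneDefect t ≤ 2 ∧ (sign t = 1 ∨ sign t = -1) := by decide
  obtain ⟨h3, h4⟩ := key t
  have h3 : (oneDefect t : ℝ) ≤ 2 := by exact_mod_cast h3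
  have := mul_le_mul_of_nonneg_left h3 hd
  rw [ratioLaw_eq]
  rcases h4 with h4 | h4 <;> rw [h4] <;> push_cast <;> linarith

/-- For the competitors with almost uniform ratio, the pairwise term with threshold `P(y)`. -/
theorem sum_ratioLaw_output_le (W : DMC D6 Y) {k : ℕ} (u v : Fin k → D6) :
    (1 / 6) * ∑ c, ∑ t, ratioLaw u v t *
      ∑ y, W.prob c y * (W.prob (t * c) y / W.output c y) ≤
        1 + 4 * digitFactor u v + |signFactor u v| := by
  set κ := 1 + 4 * digitFactor u v + |signFactor u v| with hκ
  have hκ0 : 0 ≤ κ := by have := digitFactor_nonneg u v; positivity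
  have h (c : D6) : ∑ t, ratioLaw u v t *
      ∑ y, W.prob c y * (W.prob (t * c) y / W.output c y) ≤ κ := by
    calc _ ≤ ∑ t : D6, κ / 6 * ∑ y, W.prob c y * (W.prob (t * c) y / W.output c y) := by
          refine Finset.sum_le_sum fun t _ => mul_le_mul_of_nonneg_right (ratioLaw_le u v t) ?_
          exact Finset.sum_nonneg fun y _ => mul_nonneg (W.nonneg _ _)
            (div_nonneg (W.nonneg _ _) (output_nonneg W c y))
      _ = κ * ∑ y, W.prob c y * (W.output c y / W.output c y) := by
          rw [← Finset.mul_sum, Finset.sum_comm, Finset.mul_sum, Finset.mul_sum]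
          refine Finset.sum_congr rfl fun y _ => ?_
          rw [← Finset.mul_sum, ← Finset.sum_div, sum_mulRight c fun c => W.prob c y]
          conv_rhs => rw [DMC.output]
          rw [DMC.output]; ring
      _ ≤ κ * ∑ y, W.prob c y := by
          refine mul_le_mul_of_nonneg_left (Finset.sum_le_sum fun y _ => ?_) hκ0
          exact mul_le_of_le_one_right (W.nonneg _ _) (div_self_le_one _)
      _ = κ := by rw [W.sum_eq_one, mul_one]
  have h4 := Finset.sum_le_sum fun c (_ : c ∈ Finset.univ) => h c
  rw [Finset.sum_const, Finset.card_univ, show Fintype.card D6 = 6 from rfl] at h4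
  simp only [nsmul_eq_mul, Nat.cast_ofNat] at h4
  linarith

/-! ### Bhattacharyya coefficients -/

/-- The Bhattacharyya coefficient of the output laws of two channel inputs. -/
noncomputable def DMC.bhattacharyya (W : DMC D6 Y) (a b : D6) : ℝ :=
  ∑ y, √(W.prob a y * W.prob b y)

theorem sqrt_mul_le_half_add {a b : ℝ} (ha : 0 ≤ a) (hb : 0 ≤ b) : √(a * b) ≤ (a + b) / 2 := by
  rw [Real.sqrt_le_left (by positivity)]
  nlinarith [sq_nonneg (a - b)]

theorem bhattacharyya_le_one (W : DMC D6 Y) (a b : D6) : W.bhattacharyya a b ≤ 1 := by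
  calc _ ≤ ∑ y, (W.prob a y + W.prob b y) / 2 :=
        Finset.sum_le_sum fun y _ => sqrt_mul_le_half_add (W.nonneg _ _) (W.nonneg _ _)
    _ = 1 := by
        rw [← Finset.sum_div, Finset.sum_add_distrib, W.sum_eq_one, W.sum_eq_one]; norm_num

theorem bhattacharyya_nonneg (W : DMC D6 Y) (a b : D6) : 0 ≤ W.bhattacharyya a b :=
  Finset.sum_nonneg fun _ _ => Real.sqrt_nonneg _

theorem bhattacharyya_lt_one (W : DMC D6 Y) {a b : D6} (h : W.prob a ≠ W.prob b) :
    W.bhattacharyya a b < 1 := by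
  obtain ⟨y, hy⟩ := Function.ne_iff.1 h
  calc _ < ∑ y, (W.prob a y + W.prob b y) / 2 := by
        refine Finset.sum_lt_sum
          (fun y _ => sqrt_mul_le_half_add (W.nonneg _ _) (W.nonneg _ _)) ⟨y, Finset.mem_univ y, ?_⟩
        have h1 := W.nonneg a y
        have h2 := W.nonneg b y
        have h3 : 0 < (W.prob a y - W.prob b y) ^ 2 := by
          have := sub_ne_zero.2 hy; positivity
        have h4 : 0 < W.prob a y + W.prob b y := by
          rcases h1.lt_or_eq with h | h
          · linarith
          · rcases h2.lt_or_eq with h' | h'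
            · linarith
            · exact absurd (h.symm.trans h') hy
        rw [Real.sqrt_lt' (by linarith)]
        nlinarith
    _ = 1 := by
        rw [← Finset.sum_div, Finset.sum_add_distrib, W.sum_eq_one, W.sum_eq_one]; norm_num

/-- Two codewords whose messages differ at all have a ratio that is, with probability at least
`9/10`, uniform on one of the two cosets of rotations; hence a channel that distinguishes inputs of
one coset separates them. -/
theorem exists_sum_ratioLaw_bhattacharyya_le (W : DMC D6 Y) {a : D6} {i : ZMod 3}
    (h : W.prob a ≠ W.prob (.r i * a)) :
    ∃ γ < 1, ∀ {k : ℕ} (u v : Fin k → D6), u ≠ v →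
      (1 / 6) * ∑ c, ∑ t, ratioLaw u v t * W.bhattacharyya c (t * c) ≤ γ := by
  let β (t : D6) : ℝ := (1 / 6) * ∑ c, W.bhattacharyya c (t * c)
  have hcard : ∑ _c : D6, (1 : ℝ) = 6 := by
    rw [Finset.sum_const, Finset.card_univ, show Fintype.card D6 = 6 from rfl]; norm_num
  have hle (t : D6) : β t ≤ 1 := by
    have := Finset.sum_le_sum fun c (_ : c ∈ Finset.univ) => bhattacharyya_le_one W c (t * c)
    simp only [β]; linarith
  have hlt (t c : D6) (hc : W.prob c ≠ W.prob (t * c)) : β t < 1 := by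
    have : ∑ c, W.bhattacharyya c (t * c) < ∑ _c : D6, (1 : ℝ) :=
      Finset.sum_lt_sum (fun c _ => bhattacharyya_le_one W c (t * c))
        ⟨c, Finset.mem_univ c, bhattacharyya_lt_one W hc⟩
    simp only [β]; linarith
  have hsum (f : ZMod 3 → ℝ) (hf : ∀ j, f j ≤ 1) (hj : ∃ j, f j < 1) :
      (f 0 + f 1 + f 2) / 3 < 1 := by
    obtain ⟨j, hj⟩ := hj
    have h0 := hf 0; have h1 := hf 1; have h2 := hf 2
    fin_cases j
    · change f 0 < 1 at hj; linarith
    · change f 1 < 1 at hj; linarith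
    · change f 2 < 1 at hj; linarith
  have h0 := hsum (fun j => β (.r j)) (fun j => hle _) ⟨i, hlt _ a h⟩
  have h1 : (β (.sr 0) + β (.sr 1) + β (.sr 2)) / 3 < 1 := by
    refine hsum (fun j => β (.sr j)) (fun j => hle _) ?_
    -- the output law of `sr 0 * a` differs from that of `a` or from that of `r i * a`
    by_cases e : W.prob a = W.prob (.sr 0 * a)
    · refine ⟨-i, hlt _ (.r i * a) fun e' => h ?_⟩
      rw [← mul_assoc (DihedralGroup.sr (-i)), DihedralGroup.sr_mul_r, neg_add_cancel] at e'
      rw [e, e']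
    · exact ⟨0, hlt _ a e⟩
  set b0 := (β (.r 0) + β (.r 1) + β (.r 2)) / 3
  set b1 := (β (.sr 0) + β (.sr 1) + β (.sr 2)) / 3
  refine ⟨1 / 10 + 9 / 10 * max b0 b1, by have := max_lt h0 h1; linarith, fun u v huv => ?_⟩
  have e : (1 / 6) * ∑ c, ∑ t, ratioLaw u v t * W.bhattacharyya c (t * c) =
      ∑ t, ratioLaw u v t * β t := by
    rw [Finset.sum_comm, Finset.mul_sum]
    refine Finset.sum_congr rfl fun t _ => ?_
    rw [← Finset.mul_sum]; ring
  rw [e, sum_ratioLaw_mul]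
  change digitFactor u v * _ + _ * b0 + _ * b1 ≤ _
  have hd := digitFactor_nonneg u v
  have k1 := mul_le_mul_of_nonneg_left (hle (.r 0)) hd
  have k2 := mul_le_mul_of_nonneg_left (le_max_left b0 b1)
    (sub_nonneg.2 (digitFactor_le_signFactor u v))
  have k3 := mul_le_mul_of_nonneg_left (le_max_right b0 b1)
    (show 0 ≤ (1 - signFactor u v) / 2 by linarith [signFactor_le_one u v])
  have k4 := mul_le_mul_of_nonneg_right (digitFactor_le huv)
    (show 0 ≤ 1 - max b0 b1 by linarith [max_lt h0 h1])
  linarith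

/-! ### Mutual information -/

/-- The expectation, in nats and for a uniform input, of the information density
`log (W(y|c) / Q(c, y))` relative to the reference `Q`. -/
noncomputable def DMC.information (W : DMC D6 Y) (Q : D6 → Y → ℝ) : ℝ :=
  (1 / 6) * ∑ c, ∑ y, W.prob c y * Real.log (W.prob c y / Q c y)

theorem sum_sum_prob (W : DMC D6 Y) : (1 / 6) * ∑ c, ∑ y, W.prob c y = 1 := by
  simp only [W.sum_eq_one]
  rw [Finset.sum_const, Finset.card_univ, show Fintype.card D6 = 6 from rfl]; norm_num

/-- An entropy deficit as an information, for events of conditional probability `W / (m * Q)`. -/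
theorem logb_sub_eq_information (W : DMC D6 Y) {Q : D6 → Y → ℝ}
    (hpos : ∀ c y, 0 < W.prob c y → 0 < Q c y) {m : ℝ} (hm : 0 < m) :
    Real.logb 2 m + ∑ ω : D6 × Y, jointLaw W ω *
      Real.logb 2 (jointLaw W ω / (m / 6 * Q ω.1 ω.2)) = W.information Q / Real.log 2 := by
  have e : ∑ ω : D6 × Y, jointLaw W ω * Real.logb 2 m = Real.logb 2 m := by
    rw [← Finset.sum_mul, Fintype.sum_prod_type]
    simp only [jointLaw, ← Finset.mul_sum]
    rw [sum_sum_prob, one_mul]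
  rw [← e, ← Finset.sum_add_distrib, Fintype.sum_prod_type, DMC.information, Finset.mul_sum,
    Finset.sum_div]
  refine Finset.sum_congr rfl fun c _ => ?_
  rw [Finset.mul_sum, Finset.sum_div]
  refine Finset.sum_congr rfl fun y _ => ?_
  simp only [jointLaw]
  rcases (W.nonneg c y).lt_or_eq with h | h
  · have hQ := hpos c y h
    have : W.prob c y / Q c y = m * (1 / 6 * W.prob c y / (m / 6 * Q c y)) := by
      field_simp
    rw [this, Real.log_mul hm.ne' (by positivity)]
    simp only [Real.logb]; ring
  · simp [← h]

theorem eventProb_singleton {Ω : Type*} [Fintype Ω] (p : Ω → ℝ) (S : Set Ω) (ω : Ω)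
    (h : S = {ω}) : eventProb p S = p ω := by
  classical
  subst h
  simp [eventProb, Set.indicator_apply]

theorem logb_six_sub_condEntropy (W : DMC D6 Y) :
    Real.logb 2 6 - condEntropy (jointLaw W) Prod.fst Prod.snd =
      W.information W.output / Real.log 2 := by
  rw [← logb_sub_eq_information W (fun c y => output_pos W) (by norm_num : (0 : ℝ) < 6),
    condEntropy, sub_neg_eq_add]
  congr 1
  refine Finset.sum_congr rfl fun ω _ => ?_
  rw [eventProb_singleton _ _ ω (by ext ⟨a, b⟩; simp [Prod.ext_iff])]
  congr 3
  classical
  simp only [eventProb, Set.indicator_apply, Set.mem_ofPred_eq, Fintype.sum_prod_type, jointLaw,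
    Finset.sum_ite_eq', Finset.mem_univ, if_true, DMC.output, ← Finset.mul_sum]
  ring

theorem mem_rotations {t : D6} : t ∈ rotations ↔ ∃ i, t = .r i := by
  rw [rotations, Subgroup.mem_zpowers_iff]
  constructor
  · rintro ⟨k, rfl⟩
    rw [x, DihedralGroup.r_one_zpow]; exact ⟨_, rfl⟩
  · rintro ⟨i, rfl⟩
    refine ⟨i.val, ?_⟩
    rw [x, DihedralGroup.r_one_zpow]; simp

theorem mk_mul_eq_mk_iff (t c : D6) :
    ((QuotientGroup.mk (t * c) : D6 ⧸ rotations) = QuotientGroup.mk c) ↔ ∃ i, t = .r i := by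
  rw [QuotientGroup.eq, mem_rotations]
  revert t c
  decide

theorem logb_three_sub_condEntropy (W : DMC D6 Y) :
    Real.logb 2 3 - condEntropy (jointLaw W) Prod.fst
        (fun ω => ((QuotientGroup.mk ω.1 : D6 ⧸ rotations), ω.2)) =
      W.information W.cosetOutput / Real.log 2 := by
  rw [← logb_sub_eq_information W (fun c y => cosetOutput_pos W) (by norm_num : (0 : ℝ) < 3),
    condEntropy, sub_neg_eq_add]
  congr 1
  refine Finset.sum_congr rfl fun ω _ => ?_
  rw [eventProb_singleton _ _ ω (by
    ext ⟨a, b⟩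
    simp only [Set.mem_ofPred_eq, Set.mem_singleton_iff, Prod.ext_iff]
    exact ⟨fun h => ⟨h.1, h.2.2⟩, fun h => ⟨h.1, by rw [h.1], h.2⟩⟩)]
  congr 3
  classical
  simp only [eventProb, Set.indicator_apply, Set.mem_ofPred_eq, Fintype.sum_prod_type, jointLaw,
    Prod.mk.injEq, ite_and]
  rw [← sum_mulRight ω.1]
  simp only [mk_mul_eq_mk_iff]
  have hr (j : ZMod 3) : (∃ i, DihedralGroup.r j = .r i) = True := eq_true ⟨j, rfl⟩
  have hsr (j : ZMod 3) : (∃ i, DihedralGroup.sr j = .r i) = False :=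
    eq_false fun ⟨_, h⟩ => by cases h
  rw [sum_D6]
  simp only [hr, hsr, if_true, if_false, Finset.sum_ite_eq', Finset.mem_univ,
    Finset.sum_const_zero, DMC.cosetOutput]
  ring

/-- If the rotations within a coset are indistinguishable, then the information about the input
given its coset vanishes. -/
theorem exists_prob_ne_of_information_pos (W : DMC D6 Y) (h : 0 < W.information W.cosetOutput) :
    ∃ (a : D6) (i : ZMod 3), W.prob a ≠ W.prob (.r i * a) := by
  by_contra! hc
  refine h.ne' ?_
  rw [DMC.information]
  refine mul_eq_zero_of_right _ (Finset.sum_eq_zero fun c _ => Finset.sum_eq_zero fun y _ => ?_)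
  have : W.cosetOutput c y = W.prob c y := by
    rw [DMC.cosetOutput, ← hc, ← hc, ← hc]; ring
  rw [this]
  by_cases h0 : W.prob c y = 0
  · simp [h0]
  · rw [div_self h0, Real.log_one, mul_zero]

/-- Chernoff bound for one letter: the event that the information density falls below a threshold
`τ` smaller than its mean has exponentially small probability. -/
theorem exists_chernoff_exponent (W : DMC D6 Y) {Q : D6 → Y → ℝ}
    (hpos : ∀ c y, 0 < W.prob c y → 0 < Q c y) {τ : ℝ} (hτ : τ < W.information Q) :
    ∃ s : ℝ, 0 < s ∧
      (1 / 6) * ∑ c, ∑ y, W.prob c y ^ (1 - s) * (Real.exp τ * Q c y) ^ s < 1 := by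
  let F (s : ℝ) : ℝ := (1 / 6) * ∑ c, ∑ y, W.prob c y *
    Real.exp (s * (τ - Real.log (W.prob c y / Q c y)))
  have hF0 : F 0 = 1 := by simp only [F, zero_mul, Real.exp_zero, mul_one, sum_sum_prob]
  have hderiv : HasDerivAt F (τ - W.information Q) 0 := by
    have h : HasDerivAt F ((1 / 6) * ∑ c, ∑ y, W.prob c y *
        (Real.exp (0 * (τ - Real.log (W.prob c y / Q c y))) *
          (1 * (τ - Real.log (W.prob c y / Q c y))))) 0 := by
      refine HasDerivAt.const_mul _ (HasDerivAt.fun_sum fun c _ => HasDerivAt.fun_sum fun y _ => ?_)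
      exact (((hasDerivAt_id (0 : ℝ)).mul_const _).exp).const_mul _
    convert h using 1
    simp only [zero_mul, Real.exp_zero, one_mul]
    simp only [mul_sub, Finset.sum_sub_distrib, ← Finset.sum_mul]
    rw [← mul_assoc, sum_sum_prob, DMC.information, one_mul]
  have hslope := hasDerivAt_iff_tendsto_slope.1 hderiv
  have hev : ∀ᶠ s in nhdsWithin 0 (Set.Ioi 0), slope F 0 s < 0 :=
    (hslope.mono_left (nhdsWithin_mono _ fun s (hs : 0 < s) => hs.ne')).eventually
      (gt_mem_nhds (by linarith))
  obtain ⟨s, hs, hs0, hs1⟩ := (hev.and (Ioo_mem_nhdsGT (zero_lt_one (α := ℝ)))).exists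
  refine ⟨s, hs0, ?_⟩
  have hlt : F s < 1 := by
    rw [slope_def_field, sub_zero, div_neg_iff] at hs
    rcases hs with hs | hs
    · linarith [hs.2]
    · linarith [hs.1]
  refine lt_of_eq_of_lt ?_ hlt
  simp only [F]
  congr 1
  refine Finset.sum_congr rfl fun c _ => Finset.sum_congr rfl fun y _ => ?_
  rcases (W.nonneg c y).lt_or_eq with h | h
  · have hQ := hpos c y h
    rw [Real.rpow_def_of_pos h, Real.rpow_def_of_pos (by positivity),
      Real.log_mul (Real.exp_pos _).ne' hQ.ne', Real.log_exp, Real.log_div h.ne' hQ.ne']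
    conv_rhs => enter [1]; rw [← Real.exp_log h]
    rw [← Real.exp_add, ← Real.exp_add]
    congr 1; ring
  · rw [← h, Real.zero_rpow (by linarith)]; simp

/-! ### The union bound for maximum-likelihood decoding -/

theorem sum_ensembleProb_mul_sum_prod {n k : ℕ} (u v : Fin k → D6) (φ : D6 → D6 → Y → ℝ) :
    ∑ P : CodeParams n k, P.ensembleProb *
        ∑ y : Fin n → Y, ∏ i, φ (P.encode u i) (P.encode v i) (y i) =
      ((1 / 6) * ∑ c, ∑ t, ratioLaw u v t * ∑ y, φ c (t * c) y) ^ n := by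
  classical
  rw [← sum_ensembleProb_mul_prod u v fun c c' => ∑ y, φ c c' y]
  simp only [Finset.prod_univ_sum, Fintype.piFinset_univ]

theorem sum_ensembleProb_mul_sum_prod_single {n k : ℕ} (u : Fin k → D6) (φ : D6 → Y → ℝ) :
    ∑ P : CodeParams n k, P.ensembleProb * ∑ y : Fin n → Y, ∏ i, φ (P.encode u i) (y i) =
      ((1 / 6) * ∑ c, ∑ y, φ c y) ^ n := by
  rw [sum_ensembleProb_mul_sum_prod u u fun c _ y => φ c y]
  simp only [← Finset.sum_mul, sum_ratioLaw, one_mul]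

theorem ensembleProb_nonneg {n k : ℕ} (P : CodeParams n k) : 0 ≤ P.ensembleProb :=
  mul_nonneg (Finset.prod_nonneg fun _ _ => Finset.prod_nonneg fun _ _ => pairProb_nonneg _)
    (Finset.prod_nonneg fun _ _ => by norm_num)

theorem sum_ensembleProb {n k : ℕ} : ∑ P : CodeParams n k, P.ensembleProb = 1 := by
  have := sum_ensembleProb_mul_prod (n := n) (fun _ : Fin k => (1 : D6)) (fun _ => 1)
    fun _ _ => 1
  simpa [sum_ratioLaw, Nat.card_eq_fintype_card, show Fintype.card D6 = 6 from rfl] using this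

theorem power_nonneg (W : DMC D6 Y) {n : ℕ} (c : Fin n → D6) (y : Fin n → Y) :
    0 ≤ W.power c y :=
  Finset.prod_nonneg fun _ _ => W.nonneg _ _

theorem chernoff_prod (W : DMC D6 Y) {n : ℕ} (c : Fin n → D6) (y : Fin n → Y)
    {Q : D6 → Y → ℝ} (hQ : ∀ c y, 0 ≤ Q c y) {T : ℝ} (hT : 0 < T) (s : ℝ) :
    ∏ i, W.prob (c i) (y i) ^ (1 - s) * (T * Q (c i) (y i)) ^ s =
      W.power c y ^ (1 - s) * (∏ i, T * Q (c i) (y i)) ^ s := by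
  rw [Finset.prod_mul_distrib, Real.finsetProd_rpow _ _ fun i _ => W.nonneg _ _,
    Real.finsetProd_rpow _ _ fun i _ => mul_nonneg hT.le (hQ _ _)]
  rfl

theorem le_chernoff {w q s : ℝ} (hw : 0 < w) (hs : 0 ≤ s) (h : w ≤ q) :
    w ≤ w ^ (1 - s) * q ^ s := by
  calc w = w ^ (1 - s) * w ^ s := by
        rw [← Real.rpow_add hw, sub_add_cancel, Real.rpow_one]
    _ ≤ _ := mul_le_mul_of_nonneg_left (Real.rpow_le_rpow hw.le h hs) (Real.rpow_nonneg hw.le _)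

theorem threshold_prod (W : DMC D6 Y) {n : ℕ} (c c' : Fin n → D6) (y : Fin n → Y)
    (Q : D6 → Y → ℝ) (T : ℝ) :
    ∏ i, T⁻¹ * (W.prob (c i) (y i) * (W.prob (c' i) (y i) / Q (c i) (y i))) =
      W.power c' y * (W.power c y / ∏ i, T * Q (c i) (y i)) := by
  rw [DMC.power, DMC.power, ← Finset.prod_div_distrib, ← Finset.prod_mul_distrib]
  exact Finset.prod_congr rfl fun i _ => by rw [div_eq_mul_inv, div_eq_mul_inv, mul_inv]; ring

theorem le_threshold {w w' q : ℝ} (hw : 0 < w) (hw' : w ≤ w') (hq : 0 < q) (h : q ≤ w) :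
    w ≤ w' * (w / q) :=
  hw'.trans (le_mul_of_one_le_right (hw.le.trans hw') ((one_le_div hq).2 h))

/-- The pointwise union bound. If the transmitted message `u` is not decoded, then either one of
the two information densities of its codeword is atypically small, or some other message `v` is at
least as likely; the latter is charged to the Bhattacharyya coefficient for `v ∈ A₁`, and to one of
the two thresholds for `v ∈ A₂` and `v ∈ A₃`. -/
theorem error_indicator_le (W : DMC D6 Y) {n k : ℕ} (P : CodeParams n k) (y : Fin n → Y)
    (u m : Fin k → D6) (hm : W.power (P.encode u) y ≤ W.power (P.encode m) y)
    {s₁ s₂ T₁ T₂ : ℝ} (hs₁ : 0 ≤ s₁) (hs₂ : 0 ≤ s₂) (hT₁ : 0 < T₁) (hT₂ : 0 < T₂)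
    (A₁ A₂ A₃ : Finset (Fin k → D6)) (hA : ∀ v, v ≠ u → v ∈ A₁ ∨ v ∈ A₂ ∨ v ∈ A₃) :
    (if m ≠ u then W.power (P.encode u) y else 0) ≤
      (∏ i, W.prob (P.encode u i) (y i) ^ (1 - s₁) *
        (T₁ * W.cosetOutput (P.encode u i) (y i)) ^ s₁) +
      (∏ i, W.prob (P.encode u i) (y i) ^ (1 - s₂) *
        (T₂ * W.output (P.encode u i) (y i)) ^ s₂) +
      (∑ v ∈ A₁, ∏ i, √(W.prob (P.encode u i) (y i) * W.prob (P.encode v i) (y i))) +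
      (∑ v ∈ A₂, ∏ i, T₁⁻¹ * (W.prob (P.encode u i) (y i) *
        (W.prob (P.encode v i) (y i) / W.cosetOutput (P.encode u i) (y i)))) +
      ∑ v ∈ A₃, ∏ i, T₂⁻¹ * (W.prob (P.encode u i) (y i) *
        (W.prob (P.encode v i) (y i) / W.output (P.encode u i) (y i))) := by
  have hp := W.nonneg
  have hq₁ := cosetOutput_nonneg W
  have hq₂ := output_nonneg W
  set t₁ := ∏ i, W.prob (P.encode u i) (y i) ^ (1 - s₁) *
    (T₁ * W.cosetOutput (P.encode u i) (y i)) ^ s₁ with ht₁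
  set t₂ := ∏ i, W.prob (P.encode u i) (y i) ^ (1 - s₂) *
    (T₂ * W.output (P.encode u i) (y i)) ^ s₂ with ht₂
  set f₁ : (Fin k → D6) → ℝ := fun v =>
    ∏ i, √(W.prob (P.encode u i) (y i) * W.prob (P.encode v i) (y i)) with hf₁
  set f₂ : (Fin k → D6) → ℝ := fun v => ∏ i, T₁⁻¹ * (W.prob (P.encode u i) (y i) *
        (W.prob (P.encode v i) (y i) / W.cosetOutput (P.encode u i) (y i))) with hf₂
  set f₃ : (Fin k → D6) → ℝ := fun v => ∏ i, T₂⁻¹ * (W.prob (P.encode u i) (y i) *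
        (W.prob (P.encode v i) (y i) / W.output (P.encode u i) (y i))) with hf₃
  have nt₁ : 0 ≤ t₁ := Finset.prod_nonneg fun i _ =>
    mul_nonneg (Real.rpow_nonneg (hp _ _) _) (Real.rpow_nonneg (mul_nonneg hT₁.le (hq₁ _ _)) _)
  have nt₂ : 0 ≤ t₂ := Finset.prod_nonneg fun i _ =>
    mul_nonneg (Real.rpow_nonneg (hp _ _) _) (Real.rpow_nonneg (mul_nonneg hT₂.le (hq₂ _ _)) _)
  have nf₁ (v) : 0 ≤ f₁ v := Finset.prod_nonneg fun i _ => Real.sqrt_nonneg _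
  have nf₂ (v) : 0 ≤ f₂ v := Finset.prod_nonneg fun i _ =>
    mul_nonneg (inv_nonneg.2 hT₁.le) (mul_nonneg (hp _ _) (div_nonneg (hp _ _) (hq₁ _ _)))
  have nf₃ (v) : 0 ≤ f₃ v := Finset.prod_nonneg fun i _ =>
    mul_nonneg (inv_nonneg.2 hT₂.le) (mul_nonneg (hp _ _) (div_nonneg (hp _ _) (hq₂ _ _)))
  have ns₁ : 0 ≤ ∑ v ∈ A₁, f₁ v := Finset.sum_nonneg fun v _ => nf₁ v
  have ns₂ : 0 ≤ ∑ v ∈ A₂, f₂ v := Finset.sum_nonneg fun v _ => nf₂ v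
  have ns₃ : 0 ≤ ∑ v ∈ A₃, f₃ v := Finset.sum_nonneg fun v _ => nf₃ v
  have key : m ≠ u → 0 < W.power (P.encode u) y → W.power (P.encode u) y ≤
      t₁ + t₂ + ∑ v ∈ A₁, f₁ v + ∑ v ∈ A₂, f₂ v + ∑ v ∈ A₃, f₃ v := by
    intro hmu hw
    set w := W.power (P.encode u) y with hwdef
    have hpos (i : Fin n) : 0 < W.prob (P.encode u i) (y i) :=
      (hp _ _).lt_of_ne fun h => hw.ne' (Finset.prod_eq_zero (Finset.mem_univ i) h.symm)
    rcases le_total w (∏ i, T₁ * W.cosetOutput (P.encode u i) (y i)) with h₁ | h₁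
    · have := le_chernoff hw hs₁ h₁
      rw [hwdef, ← chernoff_prod W _ _ hq₁ hT₁] at this
      linarith
    rcases le_total w (∏ i, T₂ * W.output (P.encode u i) (y i)) with h₂ | h₂
    · have := le_chernoff hw hs₂ h₂
      rw [hwdef, ← chernoff_prod W _ _ hq₂ hT₂] at this
      linarith
    rcases hA m hmu with h | h | h
    · have : w ≤ f₁ m := by
        rw [hf₁]
        simp only
        rw [← Real.sqrt_prod _ fun i _ => mul_nonneg (hp _ _) (hp _ _),
          Finset.prod_mul_distrib]
        exact Real.le_sqrt_of_sq_le (by rw [sq]; exact mul_le_mul_of_nonneg_left hm hw.le)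
      linarith [Finset.single_le_sum (fun v _ => nf₁ v) h]
    · have : w ≤ f₂ m := by
        rw [hf₂]
        simp only
        rw [threshold_prod W (P.encode u) (P.encode m)]
        exact le_threshold hw hm
          (Finset.prod_pos fun i _ => mul_pos hT₁ (cosetOutput_pos W (hpos i))) h₁
      linarith [Finset.single_le_sum (fun v _ => nf₂ v) h]
    · have : w ≤ f₃ m := by
        rw [hf₃]
        simp only
        rw [threshold_prod W (P.encode u) (P.encode m)]
        exact le_threshold hw hm
          (Finset.prod_pos fun i _ => mul_pos hT₂ (output_pos W (hpos i))) h₂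
      linarith [Finset.single_le_sum (fun v _ => nf₃ v) h]
  split_ifs with hmu
  · rcases (power_nonneg W (P.encode u) y).lt_or_eq with h | h
    · exact key hmu h
    · rw [← h]; positivity
  · positivity

theorem expected_error_le (W : DMC D6 Y) {n k : ℕ}
    (dec : CodeParams n k → (Fin n → Y) → (Fin k → D6))
    (hdec : ∀ (P : CodeParams n k) y v, W.power (P.encode v) y ≤ W.power (P.encode (dec P y)) y)
    (u : Fin k → D6)
    {s₁ s₂ T₁ T₂ : ℝ} (hs₁ : 0 ≤ s₁) (hs₂ : 0 ≤ s₂) (hT₁ : 0 < T₁) (hT₂ : 0 < T₂)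
    (A₁ A₂ A₃ : Finset (Fin k → D6)) (hA : ∀ v, v ≠ u → v ∈ A₁ ∨ v ∈ A₂ ∨ v ∈ A₃) :
    ∑ P : CodeParams n k, P.ensembleProb *
        ∑ y : Fin n → Y, (if dec P y ≠ u then W.power (P.encode u) y else 0) ≤
      ((1 / 6) * ∑ c, ∑ y, W.prob c y ^ (1 - s₁) * (T₁ * W.cosetOutput c y) ^ s₁) ^ n +
      ((1 / 6) * ∑ c, ∑ y, W.prob c y ^ (1 - s₂) * (T₂ * W.output c y) ^ s₂) ^ n +
      ∑ v ∈ A₁, ((1 / 6) * ∑ c, ∑ t, ratioLaw u v t * W.bhattacharyya c (t * c)) ^ n +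
      ∑ v ∈ A₂, (T₁⁻¹ * ((1 / 6) * ∑ c, ∑ t, ratioLaw u v t *
        ∑ y, W.prob c y * (W.prob (t * c) y / W.cosetOutput c y))) ^ n +
      ∑ v ∈ A₃, (T₂⁻¹ * ((1 / 6) * ∑ c, ∑ t, ratioLaw u v t *
        ∑ y, W.prob c y * (W.prob (t * c) y / W.output c y))) ^ n := by
  have hpull (T : ℝ) (Q : D6 → Y → ℝ) (v : Fin k → D6) :
      T⁻¹ * ((1 / 6) * ∑ c, ∑ t, ratioLaw u v t *
        ∑ y, W.prob c y * (W.prob (t * c) y / Q c y)) =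
      (1 / 6) * ∑ c, ∑ t, ratioLaw u v t *
        ∑ y, T⁻¹ * (W.prob c y * (W.prob (t * c) y / Q c y)) := by
    simp only [← Finset.mul_sum, mul_left_comm _ T⁻¹]
  simp only [hpull, DMC.bhattacharyya]
  rw [← sum_ensembleProb_mul_sum_prod_single u fun c y =>
      W.prob c y ^ (1 - s₁) * (T₁ * W.cosetOutput c y) ^ s₁,
    ← sum_ensembleProb_mul_sum_prod_single u fun c y =>
      W.prob c y ^ (1 - s₂) * (T₂ * W.output c y) ^ s₂,
    Finset.sum_congr rfl fun v _ => (sum_ensembleProb_mul_sum_prod (n := n) u v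
      fun c c' y => √(W.prob c y * W.prob c' y)).symm,
    Finset.sum_congr rfl fun v _ => (sum_ensembleProb_mul_sum_prod (n := n) u v
      fun c c' y => T₁⁻¹ * (W.prob c y * (W.prob c' y / W.cosetOutput c y))).symm,
    Finset.sum_congr rfl fun v _ => (sum_ensembleProb_mul_sum_prod (n := n) u v
      fun c c' y => T₂⁻¹ * (W.prob c y * (W.prob c' y / W.output c y))).symm,
    Finset.sum_comm (s := A₁), Finset.sum_comm (s := A₂), Finset.sum_comm (s := A₃),
    ← Finset.sum_add_distrib, ← Finset.sum_add_distrib, ← Finset.sum_add_distrib,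
    ← Finset.sum_add_distrib]
  refine Finset.sum_le_sum fun P _ => ?_
  simp only [← Finset.mul_sum, ← mul_add]
  refine mul_le_mul_of_nonneg_left ?_ (ensembleProb_nonneg P)
  rw [Finset.sum_comm (s := A₁), Finset.sum_comm (s := A₂), Finset.sum_comm (s := A₃),
    ← Finset.sum_add_distrib, ← Finset.sum_add_distrib, ← Finset.sum_add_distrib,
    ← Finset.sum_add_distrib]
  exact Finset.sum_le_sum fun y _ => error_indicator_le W P y u (dec P y) (hdec P y u)
    hs₁ hs₂ hT₁ hT₂ A₁ A₂ A₃ hA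

/-! ### Counting messages near a given one -/

/-- The number of messages satisfying a letterwise condition in at most `m` positions, weighted
by `z ^ m`. -/
theorem card_filter_mul_pow_le {k : ℕ} (r : Fin k → D6 → Prop) [∀ j a, Decidable (r j a)]
    {z b : ℝ} (hz : 0 ≤ z) (hz1 : z ≤ 1) (hb : ∀ j, ∑ a, (if r j a then z else 1) ≤ b) (m : ℕ) :
    (((Finset.univ.filter fun v : Fin k → D6 =>
      (Finset.univ.filter fun j => r j (v j)).card ≤ m).card : ℕ) : ℝ) * z ^ m ≤ b ^ k := by
  have hnn (j) (a) : 0 ≤ if r j a then z else 1 := by split_ifs <;> [exact hz; exact zero_le_one]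
  calc _ = ∑ v ∈ Finset.univ.filter fun v : Fin k → D6 =>
          (Finset.univ.filter fun j => r j (v j)).card ≤ m, z ^ m := by
        rw [Finset.sum_const, nsmul_eq_mul]
    _ ≤ ∑ v ∈ Finset.univ.filter fun v : Fin k → D6 =>
          (Finset.univ.filter fun j => r j (v j)).card ≤ m,
          ∏ j, if r j (v j) then z else 1 := by
        refine Finset.sum_le_sum fun v hv => ?_
        rw [Finset.prod_ite, Finset.prod_const, Finset.prod_const_one, mul_one]
        exact pow_le_pow_of_le_one hz hz1 (Finset.mem_filter.1 hv).2
    _ ≤ ∑ v : Fin k → D6, ∏ j, if r j (v j) then z else 1 :=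
        Finset.sum_le_sum_of_subset_of_nonneg (Finset.filter_subset _ _)
          fun v _ _ => Finset.prod_nonneg fun j _ => hnn j _
    _ = ∏ j, ∑ a, if r j a then z else 1 := by
        rw [Finset.prod_univ_sum, Fintype.piFinset_univ]
    _ ≤ ∏ _j : Fin k, b :=
        Finset.prod_le_prod (fun j _ => Finset.sum_nonneg fun a _ => hnn j a) fun j _ => hb j
    _ = b ^ k := by simp

theorem sum_ite_ne (b : D6) (z : ℝ) : ∑ a, (if b ≠ a then z else 1) = 1 + 5 * z := by
  have h : ∀ b : D6, (Finset.univ.filter fun a => b ≠ a).card = 5 ∧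
      (Finset.univ.filter fun a => ¬ b ≠ a).card = 1 := by decide
  rw [Finset.sum_ite, Finset.sum_const, Finset.sum_const, (h b).1, (h b).2]
  simp only [nsmul_eq_mul]; push_cast; ring

theorem sum_ite_yExp_ne (b : D6) (z : ℝ) :
    ∑ a, (if yExp b ≠ yExp a then z else 1) = 3 * (1 + z) := by
  have h : ∀ b : D6, (Finset.univ.filter fun a => yExp b ≠ yExp a).card = 3 ∧
      (Finset.univ.filter fun a => ¬ yExp b ≠ yExp a).card = 3 := by decide
  rw [Finset.sum_ite, Finset.sum_const, Finset.sum_const, (h b).1, (h b).2]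
  simp only [nsmul_eq_mul]; push_cast; ring

theorem digitFactor_eq {k : ℕ} (u v : Fin k → D6) :
    digitFactor u v = (1 / 10) ^ (Finset.univ.filter fun j => u j ≠ v j).card := by
  rw [digitFactor, Finset.prod_ite, Finset.prod_const_one, one_mul, Finset.prod_const]

theorem abs_signFactor_eq {k : ℕ} (u v : Fin k → D6) : |signFactor u v| =
    (4 / 5) ^ (Finset.univ.filter fun j => yExp (u j) ≠ yExp (v j)).card := by
  rw [signFactor, Finset.prod_ite, Finset.prod_const_one, one_mul, Finset.prod_const, abs_pow]
  norm_num

/-! ### Exponential decay below the critical rates -/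

theorem exists_le_exp_neg {b : ℝ} (hb : b < 1) : ∃ g : ℝ, 0 < g ∧ b ≤ Real.exp (-g) := by
  refine ⟨-Real.log (max b (1 / 2)), ?_, ?_⟩
  · have : max b (1 / 2) < 1 := max_lt hb (by norm_num)
    have := Real.log_neg (lt_max_of_lt_right (by norm_num)) this
    linarith
  · rw [neg_neg, Real.exp_log (lt_max_of_lt_right (by norm_num))]
    exact le_max_left _ _

theorem pow_le_exp {b g : ℝ} (hb : 0 ≤ b) (h : b ≤ Real.exp g) (n : ℕ) :
    b ^ n ≤ Real.exp (n * g) := by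
  rw [Real.exp_nat_mul]; exact pow_le_pow_left₀ hb h n

theorem sum_pow_le {ι : Type*} (A : Finset ι) (f : ι → ℝ) (hf : ∀ v ∈ A, 0 ≤ f v) {g a : ℝ}
    (h : ∀ v ∈ A, f v ≤ Real.exp g) {n : ℕ} (hA : (A.card : ℝ) ≤ a) :
    ∑ v ∈ A, f v ^ n ≤ a * Real.exp (n * g) := by
  calc _ ≤ ∑ v ∈ A, Real.exp (n * g) :=
        Finset.sum_le_sum fun v hv => pow_le_exp (hf v hv) (h v hv) n
    _ = A.card * Real.exp (n * g) := by rw [Finset.sum_const, nsmul_eq_mul]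
    _ ≤ _ := mul_le_mul_of_nonneg_right hA (Real.exp_pos _).le

/-- At rates below the two critical values the expected error probability of every message decays
exponentially, uniformly in the message. -/
theorem exists_exponential_bound (W : DMC D6 Y) (hJ : 0 < W.information W.cosetOutput)
    {ε : ℝ} (hε : 0 < ε) :
    ∃ C g : ℝ, 0 < g ∧ ∀ (n k : ℕ) (dec : CodeParams n k → (Fin n → Y) → (Fin k → D6)),
      (∀ (P : CodeParams n k) y v,
        W.power (P.encode v) y ≤ W.power (P.encode (dec P y)) y) →
      k * Real.log 6 ≤ n * (W.information W.output - ε) →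
      k * Real.log 3 ≤ n * (W.information W.cosetOutput - ε) → ∀ u : Fin k → D6,
      ∑ P : CodeParams n k, P.ensembleProb *
        ∑ y : Fin n → Y, (if dec P y ≠ u then W.power (P.encode u) y else 0) ≤
          C * Real.exp (-(n * g)) := by
  set J₁ := W.information W.cosetOutput
  set J₂ := W.information W.output
  obtain ⟨s₁, hs₁, hl₁⟩ := exists_chernoff_exponent W (fun c y => cosetOutput_pos W)
    (show J₁ - ε / 2 < J₁ by linarith)
  obtain ⟨s₂, hs₂, hl₂⟩ := exists_chernoff_exponent W (fun c y => output_pos W)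
    (show J₂ - ε / 2 < J₂ by linarith)
  obtain ⟨a, i, hai⟩ := exists_prob_ne_of_information_pos W hJ
  obtain ⟨γ, hγ, hbhat⟩ := exists_sum_ratioLaw_bhattacharyya_le W hai
  obtain ⟨g₁, hg₁, hl₁⟩ := exists_le_exp_neg hl₁
  obtain ⟨g₂, hg₂, hl₂⟩ := exists_le_exp_neg hl₂
  obtain ⟨g₀, hg₀, hγ⟩ := exists_le_exp_neg hγ
  -- `m` separates the near competitors, whose ratio law is far from uniform, from the others
  obtain ⟨m, hm⟩ : ∃ m : ℕ, (4 / 5 : ℝ) ^ m < ε / 20 :=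
    exists_pow_lt_of_lt_one (by positivity) (by norm_num)
  have hlog3 : 0 < Real.log 3 := Real.log_pos (by norm_num)
  set K := J₁ / Real.log 3 with hK
  have hK0 : 0 < K := by positivity
  -- the weight `z` makes the growth factors `(1 + 5 z) ^ k` and `(1 + z) ^ k` of the counts below
  -- smaller than the exponential gains
  obtain ⟨z, hz0, hz1, hzg, hzε⟩ : ∃ z : ℝ, 0 < z ∧ z ≤ 1 ∧ 5 * z * K ≤ g₀ / 2 ∧
      z * K ≤ ε / 8 := by
    refine ⟨min 1 (min (g₀ / 2 / (5 * K)) (ε / 8 / K)), by positivity, min_le_left _ _, ?_, ?_⟩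
    · have := (min_le_right 1 _).trans (min_le_left (g₀ / 2 / (5 * K)) (ε / 8 / K))
      rw [le_div_iff₀ (by positivity)] at this
      linarith
    · have := (min_le_right 1 _).trans (min_le_right (g₀ / 2 / (5 * K)) (ε / 8 / K))
      rwa [le_div_iff₀ (by positivity)] at this
  set g := min (min g₁ g₂) (min (g₀ / 2) (ε / 8)) with hg
  have hgg₁ : g ≤ g₁ := (min_le_left _ _).trans (min_le_left _ _)
  have hgg₂ : g ≤ g₂ := (min_le_left _ _).trans (min_le_right _ _)
  have hgg₀ : g ≤ g₀ / 2 := (min_le_right _ _).trans (min_le_left _ _)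
  have hgε : g ≤ ε / 8 := (min_le_right _ _).trans (min_le_right _ _)
  refine ⟨3 + 2 * (z ^ m)⁻¹, g, by positivity, fun n k dec hdec hk₂ hk₁ u => ?_⟩
  have hn : (0 : ℝ) ≤ n := n.cast_nonneg
  have hkK : (k : ℝ) ≤ K * n := by
    rw [hK, div_mul_eq_mul_div, le_div_iff₀ hlog3]
    nlinarith
  have hzm : 0 < z ^ m := by positivity
  classical
  let D (v : Fin k → D6) : ℕ := (Finset.univ.filter fun j => u j ≠ v j).card
  let E (v : Fin k → D6) : ℕ := (Finset.univ.filter fun j => yExp (u j) ≠ yExp (v j)).card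
  have hED (v) : E v ≤ D v := Finset.card_le_card fun j hj => by
    simp only [Finset.mem_filter, Finset.mem_univ, true_and] at hj ⊢
    exact fun h => hj (by rw [h])
  let A₁ : Finset (Fin k → D6) := Finset.univ.filter fun v => D v ≤ m ∧ v ≠ u
  let A₂ : Finset (Fin k → D6) := Finset.univ.filter fun v => E v ≤ m ∧ m < D v
  let A₃ : Finset (Fin k → D6) := Finset.univ.filter fun v => m < E v
  have hA (v) (hv : v ≠ u) : v ∈ A₁ ∨ v ∈ A₂ ∨ v ∈ A₃ := by
    simp only [A₁, A₂, A₃, Finset.mem_filter, Finset.mem_univ, true_and]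
    have := hED v
    by_cases h : D v ≤ m
    · exact Or.inl ⟨h, hv⟩
    · by_cases h' : E v ≤ m
      · exact Or.inr (Or.inl ⟨h', by omega⟩)
      · exact Or.inr (Or.inr (by omega))
  have hd (v) (hv : m < D v) : digitFactor u v ≤ ε / 20 := by
    rw [digitFactor_eq]
    refine le_trans ?_ hm.le
    calc (1 / 10 : ℝ) ^ D v ≤ (1 / 10) ^ m :=
          pow_le_pow_of_le_one (by norm_num) (by norm_num) hv.le
      _ ≤ _ := pow_le_pow_left₀ (by norm_num) (by norm_num) m
  have hs (v) (hv : m < E v) : |signFactor u v| ≤ ε / 20 := by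
    rw [abs_signFactor_eq]
    exact (pow_le_pow_of_le_one (by norm_num) (by norm_num) hv.le).trans hm.le
  have hc₁ : (A₁.card : ℝ) ≤ (z ^ m)⁻¹ * Real.exp (n * (g₀ / 2)) := by
    have h := card_filter_mul_pow_le (fun j a => u j ≠ a) hz0.le hz1
      (fun j => (sum_ite_ne (u j) z).le) m
    have h' : (A₁.card : ℝ) ≤ ((Finset.univ.filter fun v => D v ≤ m).card : ℕ) :=
      Nat.cast_le.2 (Finset.card_le_card fun v hv => by
        simp only [A₁, Finset.mem_filter, Finset.mem_univ, true_and] at hv ⊢; exact hv.1)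
    have h'' : (1 + 5 * z) ^ k ≤ Real.exp (n * (g₀ / 2)) := by
      refine (pow_le_exp (g := 5 * z) (by positivity)
        (by linarith [Real.add_one_le_exp (5 * z)]) k).trans ?_
      rw [Real.exp_le_exp]
      nlinarith
    rw [inv_mul_eq_div, le_div_iff₀ hzm]
    exact (mul_le_mul_of_nonneg_right h' hzm.le).trans (h.trans h'')
  have hc₂ : (A₂.card : ℝ) ≤ (z ^ m)⁻¹ * Real.exp (n * (J₁ - ε + ε / 8)) := by
    have h := card_filter_mul_pow_le (fun j a => yExp (u j) ≠ yExp a) hz0.le hz1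
      (fun j => (sum_ite_yExp_ne (u j) z).le) m
    have h' : (A₂.card : ℝ) ≤ ((Finset.univ.filter fun v => E v ≤ m).card : ℕ) :=
      Nat.cast_le.2 (Finset.card_le_card fun v hv => by
        simp only [A₂, Finset.mem_filter, Finset.mem_univ, true_and] at hv ⊢; exact hv.1)
    have h'' : (3 * (1 + z)) ^ k ≤ Real.exp (n * (J₁ - ε + ε / 8)) := by
      refine (pow_le_exp (g := Real.log 3 + z) (by positivity) ?_ k).trans ?_
      · rw [Real.exp_add, Real.exp_log (by norm_num)]
        linarith [Real.add_one_le_exp z]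
      · rw [Real.exp_le_exp]
        nlinarith
    rw [inv_mul_eq_div, le_div_iff₀ hzm]
    exact (mul_le_mul_of_nonneg_right h' hzm.le).trans (h.trans h'')
  have hc₃ : (A₃.card : ℝ) ≤ Real.exp (n * (J₂ - ε)) := by
    have h : (A₃.card : ℝ) ≤ 6 ^ k := by
      have := Finset.card_le_univ A₃
      rw [Fintype.card_fun, Fintype.card_fin, show Fintype.card D6 = 6 from rfl] at this
      exact_mod_cast this
    refine h.trans ((pow_le_exp (by norm_num) (Real.exp_log (by norm_num)).ge k).trans ?_)
    rwa [Real.exp_le_exp]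
  have hW := W.nonneg
  have hq₁ := cosetOutput_nonneg W
  have hq₂ := output_nonneg W
  have hr (v t) := ratioLaw_nonneg u v t
  have hthr {τ κ : ℝ} (hκ : κ ≤ 1 + ε / 4) :
      (Real.exp τ)⁻¹ * κ ≤ Real.exp (-τ + ε / 4) := by
    rw [← Real.exp_neg, Real.exp_add]
    exact mul_le_mul_of_nonneg_left (by linarith [Real.add_one_le_exp (ε / 4)])
      (Real.exp_pos _).le
  refine (expected_error_le W dec hdec u hs₁.le hs₂.le (Real.exp_pos (J₁ - ε / 2))
    (Real.exp_pos (J₂ - ε / 2)) A₁ A₂ A₃ hA).trans ?_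
  have e₁ := pow_le_exp (mul_nonneg (by norm_num) (Finset.sum_nonneg fun c _ =>
    Finset.sum_nonneg fun y _ => mul_nonneg (Real.rpow_nonneg (hW c y) _)
      (Real.rpow_nonneg (mul_nonneg (Real.exp_pos _).le (hq₁ c y)) _))) hl₁ n
  have e₂ := pow_le_exp (mul_nonneg (by norm_num) (Finset.sum_nonneg fun c _ =>
    Finset.sum_nonneg fun y _ => mul_nonneg (Real.rpow_nonneg (hW c y) _)
      (Real.rpow_nonneg (mul_nonneg (Real.exp_pos _).le (hq₂ c y)) _))) hl₂ n
  have e₃ := sum_pow_le A₁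
    (fun v => (1 / 6) * ∑ c, ∑ t, ratioLaw u v t * W.bhattacharyya c (t * c))
    (fun v _ => mul_nonneg (by norm_num) (Finset.sum_nonneg fun c _ => Finset.sum_nonneg
      fun t _ => mul_nonneg (hr v t) (bhattacharyya_nonneg W _ _)))
    (fun v hv => (hbhat u v (Finset.mem_filter.1 hv).2.2.symm).trans hγ) (n := n) hc₁
  have e₄ := sum_pow_le A₂
    (fun v => (Real.exp (J₁ - ε / 2))⁻¹ * ((1 / 6) * ∑ c, ∑ t, ratioLaw u v t *
      ∑ y, W.prob c y * (W.prob (t * c) y / W.cosetOutput c y)))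
    (fun v _ => mul_nonneg (inv_nonneg.2 (Real.exp_pos _).le) (mul_nonneg (by norm_num)
      (Finset.sum_nonneg fun c _ => Finset.sum_nonneg fun t _ => mul_nonneg (hr v t)
        (Finset.sum_nonneg fun y _ => mul_nonneg (hW _ _) (div_nonneg (hW _ _) (hq₁ _ _))))))
    (fun v hv => hthr ((sum_ratioLaw_cosetOutput_le W u v).trans (by
      linarith [hd v (Finset.mem_filter.1 hv).2.2]))) (n := n) hc₂
  have e₅ := sum_pow_le A₃
    (fun v => (Real.exp (J₂ - ε / 2))⁻¹ * ((1 / 6) * ∑ c, ∑ t, ratioLaw u v t *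
      ∑ y, W.prob c y * (W.prob (t * c) y / W.output c y)))
    (fun v _ => mul_nonneg (inv_nonneg.2 (Real.exp_pos _).le) (mul_nonneg (by norm_num)
      (Finset.sum_nonneg fun c _ => Finset.sum_nonneg fun t _ => mul_nonneg (hr v t)
        (Finset.sum_nonneg fun y _ => mul_nonneg (hW _ _) (div_nonneg (hW _ _) (hq₂ _ _))))))
    (fun v hv => hthr ((sum_ratioLaw_output_le W u v).trans (by
      have hv := (Finset.mem_filter.1 hv).2
      linarith [hd v (hv.trans_le (hED v)), hs v hv]))) (n := n) hc₃
  rw [mul_assoc, ← Real.exp_add] at e₃ e₄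
  rw [← Real.exp_add] at e₅
  have hexp {r : ℝ} (h : r ≤ -g) : Real.exp (n * r) ≤ Real.exp (-(n * g)) := by
    rw [Real.exp_le_exp, ← mul_neg]; exact mul_le_mul_of_nonneg_left h hn
  have x₁ := hexp (show -g₁ ≤ -g by linarith)
  have x₂ := hexp (show -g₂ ≤ -g by linarith)
  have x₃ := mul_le_mul_of_nonneg_left (hexp (show g₀ / 2 + -g₀ ≤ -g by linarith))
    (inv_nonneg.2 hzm.le)
  have x₄ := mul_le_mul_of_nonneg_left
    (hexp (show J₁ - ε + ε / 8 + (-(J₁ - ε / 2) + ε / 4) ≤ -g by linarith))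
    (inv_nonneg.2 hzm.le)
  have x₅ := hexp (show J₂ - ε + (-(J₂ - ε / 2) + ε / 4) ≤ -g by linarith)
  rw [mul_add] at x₃ x₄ x₅
  linarith

/-! ### Achievability -/

theorem exists_maximumLikelihood_decoder (W : DMC D6 Y) (n k : ℕ) :
    ∃ dec : CodeParams n k → (Fin n → Y) → (Fin k → D6), ∀ (P : CodeParams n k) y v,
      W.power (P.encode v) y ≤ W.power (P.encode (dec P y)) y := by
  choose dec hdec using fun (P : CodeParams n k) (y : Fin n → Y) =>
    Finite.exists_max fun v => W.power (P.encode v) y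
  exact ⟨dec, hdec⟩

theorem expected_avgError_le (W : DMC D6 Y) {n k : ℕ}
    (dec : CodeParams n k → (Fin n → Y) → (Fin k → D6)) {b : ℝ}
    (h : ∀ u : Fin k → D6, ∑ P : CodeParams n k, P.ensembleProb *
      ∑ y : Fin n → Y, (if dec P y ≠ u then W.power (P.encode u) y else 0) ≤ b) :
    ∑ P : CodeParams n k, P.ensembleProb * avgError W P.encode (dec P) ≤ b := by
  have e : ∑ P : CodeParams n k, P.ensembleProb * avgError W P.encode (dec P) =
      (1 / (Fintype.card (Fin k → D6) : ℝ)) * ∑ u, ∑ P : CodeParams n k, P.ensembleProb *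
        ∑ y : Fin n → Y, (if dec P y ≠ u then W.power (P.encode u) y else 0) := by
    rw [Finset.sum_comm, Finset.mul_sum]
    refine Finset.sum_congr rfl fun P _ => ?_
    rw [avgError, ← Finset.mul_sum]; ring
  have hM : (0 : ℝ) < Fintype.card (Fin k → D6) := Nat.cast_pos.2 Fintype.card_pos
  have := Finset.sum_le_sum fun u (_ : u ∈ Finset.univ) => h u
  rw [Finset.sum_const, Finset.card_univ, nsmul_eq_mul] at this
  rw [e, one_div, inv_mul_le_iff₀ hM]
  exact this

theorem isAchievableByEnsemble_rateStar (W : DMC D6 Y) :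
    IsAchievableByEnsemble W (rateStar W) := by
  intro ε hε
  set R := rateStar W with hR
  set L := Real.logb 2 6 with hL
  have hlog2 : 0 < Real.log 2 := Real.log_pos (by norm_num)
  have hlog3 : 0 < Real.log 3 := Real.log_pos (by norm_num)
  have hlog6 : 0 < Real.log 6 := Real.log_pos (by norm_num)
  have hL0 : 0 < L := div_pos hlog6 hlog2
  have hLlog : L * Real.log 2 = Real.log 6 := div_mul_cancel₀ _ hlog2.ne'
  by_cases hRε : R ≤ ε
  · -- a single message is transmitted without error
    refine ⟨0, fun n _ => ⟨0, fun _ _ => default, by simpa using hRε, ?_⟩⟩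
    refine expected_avgError_le W _ fun u => ?_
    simpa [Subsingleton.elim u default] using hε.le
  push Not at hRε
  set J₁ := W.information W.cosetOutput
  set J₂ := W.information W.output
  set q := Real.log 3 / Real.log 6 with hq
  have hq0 : 0 < q := by positivity
  have hq1 : q ≤ 1 := (div_le_one hlog6).2 (Real.log_le_log (by norm_num) (by norm_num))
  have hqlog : Real.log 6 * q = Real.log 3 := mul_div_cancel₀ _ hlog6.ne'
  have hR₂ : R * Real.log 2 ≤ J₂ := by
    rw [← le_div_iff₀ hlog2, ← logb_six_sub_condEntropy]
    exact min_le_left _ _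
  have hR₁ : R * Real.log 2 * q ≤ J₁ := by
    have h : R ≤ L / Real.logb 2 3 * (J₁ / Real.log 2) := by
      rw [← logb_three_sub_condEntropy]
      exact min_le_right _ _
    have h' : L / Real.logb 2 3 * (J₁ / Real.log 2) = J₁ / (Real.log 2 * q) := by
      simp only [hL, hq, Real.logb]; field_simp
    rwa [h', le_div_iff₀ (by positivity), ← mul_assoc] at h
  have hJ₁ : 0 < J₁ := lt_of_lt_of_le (by have := hε.trans hRε; positivity) hR₁
  set δ := ε * Real.log 2 * q / 2 with hδ
  have hδ0 : 0 < δ := by positivity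
  obtain ⟨C, g, hg, hbound⟩ := exists_exponential_bound W hJ₁ hδ0
  have htend : Filter.Tendsto (fun n : ℕ => C * Real.exp (-((n : ℝ) * g))) Filter.atTop
      (nhds (C * 0)) :=
    (Real.tendsto_exp_neg_atTop_nhds_zero.comp
      (tendsto_natCast_atTop_atTop.atTop_mul_const hg)).const_mul C
  rw [mul_zero] at htend
  obtain ⟨N₁, hN₁⟩ := Filter.eventually_atTop.1 (htend.eventually_le_const hε)
  obtain ⟨N₂, hN₂⟩ := exists_nat_ge (Real.log 6 / δ)
  refine ⟨max (max N₁ N₂) 1, fun n hn => ?_⟩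
  have hn₁ : N₁ ≤ n := (le_max_left _ _).trans ((le_max_left _ _).trans hn)
  have hn₂ : Real.log 6 ≤ n * δ := by
    rw [← div_le_iff₀ hδ0]
    exact hN₂.trans (Nat.cast_le.2 ((le_max_right _ _).trans ((le_max_left _ _).trans hn)))
  have hn0 : (0 : ℝ) < n := Nat.cast_pos.2 ((le_max_right _ _).trans hn)
  obtain ⟨dec, hdec⟩ := exists_maximumLikelihood_decoder W n ⌈n * (R - ε) / L⌉₊
  have hk : (⌈n * (R - ε) / L⌉₊ : ℝ) ≤ n * (R - ε) / L + 1 :=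
    (Nat.ceil_lt_add_one (div_nonneg (mul_nonneg hn0.le (by linarith)) hL0.le)).le
  have hk' : (⌈n * (R - ε) / L⌉₊ : ℝ) * Real.log 6 ≤
      n * (R * Real.log 2 - ε * Real.log 2) + Real.log 6 := by
    have h := mul_le_mul_of_nonneg_right hk hlog6.le
    have h' : (n * (R - ε) / L + 1) * Real.log 6 =
        n * (R * Real.log 2 - ε * Real.log 2) + Real.log 6 := by
      rw [← hLlog]; field_simp
    rwa [h'] at h
  refine ⟨⌈n * (R - ε) / L⌉₊, dec, ?_, (expected_avgError_le W dec
    (hbound n _ dec hdec ?_ ?_)).trans (hN₁ n hn₁)⟩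
  · have := Nat.le_ceil (n * (R - ε) / L)
    rw [div_le_iff₀ hL0] at this
    rw [div_mul_eq_mul_div, le_div_iff₀ hn0]
    linarith
  · have h1 := mul_le_mul_of_nonneg_left hR₂ hn0.le
    have h2 : 2 * δ ≤ ε * Real.log 2 := by
      rw [hδ]
      have := mul_le_of_le_one_right (show 0 ≤ ε * Real.log 2 by positivity) hq1
      linarith
    have h3 := mul_le_mul_of_nonneg_left h2 hn0.le
    linarith
  · have h1 := mul_le_mul_of_nonneg_left hR₁ hn0.le
    have h2 := mul_le_mul_of_nonneg_right hk' hq0.le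
    have h3 := mul_le_of_le_one_right hlog6.le hq1
    rw [mul_assoc, hqlog] at h2
    rw [hδ] at hn₂ ⊢
    linarith

theorem admissible_of_ensembleProb_pos {n k : ℕ} (P : CodeParams n k)
    (h : 0 < P.ensembleProb) : P.Admissible := by
  intro i j
  by_contra hP
  refine h.ne' (mul_eq_zero_of_left (Finset.prod_eq_zero (Finset.mem_univ i)
    (Finset.prod_eq_zero (Finset.mem_univ j) (if_neg hP))) _)

theorem avgError_comp_equiv {X M M' : Type*} [Fintype M] [DecidableEq M] [Fintype M']
    [DecidableEq M'] (W : DMC X Y) {n : ℕ} (σ : M' ≃ M) (e : M → Fin n → X)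
    (f : (Fin n → Y) → M) :
    avgError W (fun m => e (σ m)) (fun y => σ.symm (f y)) = avgError W e f := by
  rw [avgError, avgError, Fintype.card_congr σ]
  congr 1
  refine Fintype.sum_equiv σ _ _ fun m => Finset.sum_congr rfl fun y _ => ?_
  simp only [ne_eq, Equiv.symm_apply_eq]

/-- Some code of the ensemble is at least as good as the expectation. -/
theorem isAchievableUsing_of_ensemble (W : DMC D6 Y) {R : ℝ} (h : IsAchievableByEnsemble W R) :
    IsAchievableUsing pseudoGroupEncoders W R := by
  intro ε hε
  obtain ⟨N, hN⟩ := h ε hε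
  refine ⟨N, fun n hn => ?_⟩
  obtain ⟨k, dec, hrate, herr⟩ := hN n hn
  obtain ⟨P, hP, hPε⟩ : ∃ P : CodeParams n k, 0 < P.ensembleProb ∧
      avgError W P.encode (dec P) ≤ ε := by
    by_contra! hc
    obtain ⟨P₀, hP₀⟩ : ∃ P : CodeParams n k, 0 < P.ensembleProb := by
      by_contra! h0
      have := Finset.sum_nonpos fun P (_ : P ∈ (Finset.univ : Finset (CodeParams n k))) => h0 P
      rw [sum_ensembleProb] at this
      linarith
    have : ∑ P : CodeParams n k, P.ensembleProb * ε <
        ∑ P : CodeParams n k, P.ensembleProb * avgError W P.encode (dec P) := by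
      refine Finset.sum_lt_sum (fun P _ => ?_)
        ⟨P₀, Finset.mem_univ _, mul_lt_mul_of_pos_left (hc P₀ hP₀) hP₀⟩
      rcases (ensembleProb_nonneg P).lt_or_eq with h | h
      · exact mul_le_mul_of_nonneg_left (hc P h).le h.le
      · rw [← h, zero_mul, zero_mul]
    rw [← Finset.sum_mul, sum_ensembleProb, one_mul] at this
    linarith
  let σ : Fin (6 ^ k) ≃ (Fin k → D6) := Fintype.equivOfCardEq (by
    rw [Fintype.card_fin, Fintype.card_fun, Fintype.card_fin]; rfl)
  refine ⟨6 ^ k, fun m => P.encode (σ m), fun y => σ.symm (dec P y),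
    ⟨k, P, σ, admissible_of_ensembleProb_pos P hP, fun _ => rfl⟩, ?_, ?_⟩
  · rw [Nat.cast_pow, Real.logb_pow]
    refine hrate.trans (le_of_eq ?_)
    push_cast; ring
  · rw [avgError_comp_equiv]; exact hPε

end PseudoGroup

theorem theorem2 {Y : Type*} [Fintype Y] (W : PseudoGroup.DMC PseudoGroup.D6 Y) :
    PseudoGroup.IsAchievableUsing PseudoGroup.pseudoGroupEncoders W (PseudoGroup.rateStar W) ∧
      PseudoGroup.IsAchievableByEnsemble W (PseudoGroup.rateStar W) :=
  have h := PseudoGroup.isAchievableByEnsemble_rateStar W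
  ⟨PseudoGroup.isAchievableUsing_of_ensemble W h, h⟩
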